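/- Let $f:[0,1]\to[0,1]$ be a strictly increasing continuous function with $f(0)=0$, $f(1)<1$ and $|f(x)-f(y)|\le\kappa|x-y|$ for all $x,y\in[0,1]$, for some constant $\kappa<1$. For $c\in(0,1)$ define $T_c:[0,1)\to[0,1)$ by $$T_c(x)=\begin{cases} f(x)-f(c)+1 & (0\le x<c),\\ f(x)-f(c) & (c\le x<1).\end{cases}$$ For $\alpha,\beta\in(0,1)$ let $S_{\alpha,\beta}:[0,1)\to[0,1)$, $S_{\alpha,\beta}(x)=\alpha x+\beta \pmod 1$. Call a pair $(n,l)$ of non-negative integers admissible if $n\ge2$, $l<n$ and $\gcd(n,l)=1$. For such a pair put $k_m=\lfloor (m+1)l/n\rfloor-\lfloor ml/n\rfloor$ for $m\in\mathbb Z$, $$B^U_{n,l}(\alpha)=(1-\alpha)\Bigl(\frac1{1-\alpha^n}\sum_{m=1}^{n-1}k_m\alpha^m+1\Bigr),\qquad B^L_{n,l}(\alpha)=(1-\alpha)\Bigl(\frac1{1-\alpha^n}\sum_{m=1}^{n-1}k_m\alpha^m+1-\frac{\alpha^{n-1}-\alpha^n}{1-\alpha^n}\Bigr),$$ and $D_{n,l}=\{(\alpha,\beta)\in(0,1)^2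 : B^L_{n,l}(\alpha)\le\beta<B^U_{n,l}(\alpha)\}$. Then for every admissible $(n,l)$ the interior of $D_{n,l}$ is non-empty and there are numbers $0<c^L_{n,l}<c^R_{n,l}<1$ such that: (i) if $c\in(c^L_{n,l},c^R_{n,l})$, then $T_c$ is topologically conjugate to $S_{\alpha,\beta}$ for every $(\alpha,\beta)\in\operatorname{int}(D_{n,l})$, i.e. there is a homeomorphism $\varphi$ of $[0,1)$ onto itself with $\varphi\circ T_c=S_{\alpha,\beta}\circ\varphi$; (ii) if $(n,l)$ and $(n',l')$ are admissible and $n'l-nl'=1$, then $c^R_{n,l}<c^L_{n+n',l+l'}<c^R_{n+n',l+l'}<c^L_{n',l'}$. -/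

import Mathlib

open Set

/-- The piecewise linear contracting map `S_{α,β}(x) = α x + β (mod 1)`. -/
noncomputable def linearMap (α β : ℝ) (x : ℝ) : ℝ := Int.fract (α * x + β)

/-- The rational characteristic sequence `k_m = [(m+1)l/n] - [ml/n]` with respect to `(n, l)`. -/
noncomputable def charSeq (n l : ℕ) (m : ℤ) : ℤ :=
  ⌊((m + 1) * l : ℝ) / n⌋ - ⌊(m * l : ℝ) / n⌋

/-- The upper boundary function `B^U_{n,l}`. -/
noncomputable def upperB (n l : ℕ) (α : ℝ) : ℝ :=
  (1 - α) * (1 / (1 - α ^ n) * (∑ m ∈ Finset.Icc 1 (n - 1), (charSeq n l m : ℝ) * α ^ m) + 1)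

/-- The lower boundary function `B^L_{n,l}`. -/
noncomputable def lowerB (n l : ℕ) (α : ℝ) : ℝ :=
  (1 - α) * (1 / (1 - α ^ n) * (∑ m ∈ Finset.Icc 1 (n - 1), (charSeq n l m : ℝ) * α ^ m) + 1
    - (α ^ (n - 1) - α ^ n) / (1 - α ^ n))

/-- The parameter region `D_{n,l} ⊆ (0,1)²`. -/
def regionD (n l : ℕ) : Set (ℝ × ℝ) :=
  {p | p.1 ∈ Ioo (0 : ℝ) 1 ∧ p.2 ∈ Ioo (0 : ℝ) 1 ∧ lowerB n l p.1 ≤ p.2 ∧ p.2 < upperB n l p.1}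

/-- The map `T_c`: `f x - f c + 1` to the left of `c`, and `f x - f c` from `c` on.
It is used on `[0,1)` only. -/
noncomputable def familyMap (f : ℝ → ℝ) (c : ℝ) (x : ℝ) : ℝ :=
  if x < c then f x - f c + 1 else f x - f c

/-- Topological conjugacy of two (possibly discontinuous) self-maps of `[0,1)`:
both map `[0,1)` into itself, and some homeomorphism `φ` of `[0,1)` satisfies `φ ∘ F = G ∘ φ`. -/
def TopConjugate (F G : ℝ → ℝ) : Prop :=
  ∃ (hF : MapsTo F (Ico (0 : ℝ) 1) (Ico 0 1)) (hG : MapsTo G (Ico (0 : ℝ) 1) (Ico 0 1))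
    (φ : Ico (0 : ℝ) 1 ≃ₜ Ico (0 : ℝ) 1),
    Function.Semiconj φ (hF.restrict F _ _) (hG.restrict G _ _)

/-- The admissible pairs: `n ≥ 2` and `l < n` with `gcd(n, l) = 1`. -/
def Admissible (n l : ℕ) : Prop := 2 ≤ n ∧ l < n ∧ Nat.Coprime n l

/-! With f extended to a contraction `g` of the line, both T_c and S_{α,β} are reductions mod 1 of
lifts x ↦ g(x - ⌊x⌋) + ⌊x⌋ + d, with d = 1 - f(c) in the first case, and with g(x) = αx and d = β in
the second. It therefore suffices to treat such lifts.

Fix l/n. Prescribe in advance which integer cell each point of an ordered periodic orbit occupies.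
The orbit equation then becomes a fixed-point equation for a contraction of a space of bounded
sequences, so it has exactly one solution `P` for every d (`exists_isOrbit`, `IsOrbit.unique`). A
comparison principle makes `P` increasing in its index and in d. It is a true orbit avoiding the
discontinuity as soon as P 0 < 0 < P 1. These conditions define an open interval of translations,
whose lower end has P 1 = 0 and whose upper end has P 0 = 0. For T_c this interval becomes (c^L,
c^R), with its ends swapped because d decreases with c. For the linear map, solving for P 0 and P 1
explicitly gives B^U and B^L as its ends. Comparing two end orbits of different rotation numbers
orders the intervals (`IsOrbit.lt_of_rotation_lt`).

The conjugacy is symbolic. The image of the lift omits, mod 1, one gap [g 1 - 1 + d, d). Each point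
of the line lies on `P` or is, up to an integer, an iterate of a gap point
(`IsLocked.point_surjective`). The gap contains a point q that reaches the discontinuity after n - 1
steps. Parametrising the gap on both sides of q gives addresses whose order depends only on n and l
(`IsLocked.point_lt_of_key_lt`). Matching addresses of two locked lifts gives an order isomorphism
of the line that commutes with the dynamics and with integer translations and fixes 0
(`IsLocked.exists_conj`); it restricts to [0,1). -/

/-- A strictly increasing `κ`-contraction `g` of the line with `g 0 = 0` and `g 1 < 1`. -/
structure IsContractiveProfile (g : ℝ → ℝ) (κ : ℝ) : Prop where
  pos : 0 < κ
  lt_one : κ < 1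
  strictMono : StrictMono g
  sub_le : ∀ x y, x ≤ y → g y - g x ≤ κ * (y - x)
  zero : g 0 = 0
  one_lt : g 1 < 1

/-! ### Prescribed cells and elementary properties of profiles -/

/-- The integer part of the `s`-th point of an orbit with rotation number `l / n`. -/
def cell (n : ℕ) (s : ℤ) : ℤ := (s - 1) / n

lemma cell_add_self {n : ℕ} (hn : 0 < n) (s : ℤ) : cell n (s + n) = cell n s + 1 := by
  unfold cell
  rw [show s + n - 1 = (s - 1) + n by ring, Int.add_ediv_of_dvd_right (dvd_refl _),
    Int.ediv_self (by omega)]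

lemma cell_mono (n : ℕ) : Monotone (cell n) := by
  intro s t h
  rcases Nat.eq_zero_or_pos n with rfl | hn
  · simp [cell]
  · exact Int.ediv_le_ediv (by omega) (by omega)

lemma cell_eq_neg_one {n : ℕ} (s : ℤ) (h1 : -n < s) (h2 : s ≤ 0) : cell n s = -1 := by
  unfold cell
  rw [Int.ediv_eq_iff_of_pos (by omega)]
  constructor <;> linarith

lemma cell_eq_zero {n : ℕ} (s : ℤ) (h1 : 0 < s) (h2 : s ≤ n) : cell n s = 0 := by
  unfold cell
  exact Int.ediv_eq_zero_of_lt (by omega) (by omega)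

/-- The cell changes only between a multiple of n and its successor, so only arcs of the orbit with
index divisible by n can contain a discontinuity. -/
lemma cell_succ_of_not_dvd {n : ℕ} (hn : 0 < n) {s : ℤ} (h : ¬ (n : ℤ) ∣ s) :
    cell n (s + 1) = cell n s := by
  unfold cell
  have h1 := Int.emod_add_mul_ediv s n
  have h2 := Int.emod_nonneg s (show (n : ℤ) ≠ 0 by omega)
  have h3 := Int.emod_lt_of_pos s (show (0 : ℤ) < n by omega)
  have h4 : s % n ≠ 0 := fun h' => h (Int.dvd_of_emod_eq_zero h')
  have h5 : (s - 1) / n = s / n := by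
    rw [Int.ediv_eq_iff_of_pos (by omega)]
    constructor <;> nlinarith [h2.lt_of_ne' h4]
  simp [h5]

lemma abs_cell_sub_le {n : ℕ} (hn : 0 < n) (s : ℤ) : |(cell n s : ℝ) - s / n| ≤ 1 := by
  unfold cell
  have hn' : (0 : ℝ) < n := by exact_mod_cast hn
  have h1 := Int.emod_add_mul_ediv (s - 1) n
  have h2 := Int.emod_nonneg (s - 1) (show (n : ℤ) ≠ 0 by omega)
  have h3 := Int.emod_lt_of_pos (s - 1) (show (0 : ℤ) < n by omega)
  generalize (s - 1) / n = c at *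
  generalize (s - 1) % n = r at *
  have hs : s = r + n * c + 1 := by omega
  have h3' : (r : ℝ) + 1 ≤ n := by exact_mod_cast h3
  have h2' : (0 : ℝ) ≤ r := by exact_mod_cast h2
  rw [hs]
  push_cast
  have : (c : ℝ) - (r + n * c + 1) / n = -((r + 1) / n) := by field_simp; ring
  rw [this, abs_neg, abs_of_nonneg (by positivity), div_le_one hn']
  exact h3'

namespace IsContractiveProfile

variable {g : ℝ → ℝ} {κ : ℝ}

lemma sub_le_max (hg : IsContractiveProfile g κ) (x y : ℝ) :
    g x - g y ≤ κ * max (x - y) 0 := by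
  rcases le_total y x with h | h
  · rw [max_eq_left (by linarith)]
    exact hg.sub_le y x h
  · have := hg.strictMono.monotone h
    have := mul_nonneg hg.pos.le (le_max_right (x - y) 0)
    linarith

lemma abs_sub_le (hg : IsContractiveProfile g κ) (x y : ℝ) : |g x - g y| ≤ κ * |x - y| := by
  rcases le_total y x with h | h
  · rw [abs_of_nonneg (sub_nonneg.2 h), abs_of_nonneg (sub_nonneg.2 (hg.strictMono.monotone h))]
    exact hg.sub_le y x h
  · rw [abs_sub_comm, abs_sub_comm x, abs_of_nonneg (sub_nonneg.2 h),
      abs_of_nonneg (sub_nonneg.2 (hg.strictMono.monotone h))]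
    exact hg.sub_le x y h

lemma continuous (hg : IsContractiveProfile g κ) : Continuous g := by
  have : LipschitzWith (NNReal.mk κ hg.pos.le) g := LipschitzWith.of_dist_le_mul fun x y => by
    simpa [Real.dist_eq] using hg.abs_sub_le x y
  exact this.continuous

/-- Moving a branch of the lift to a higher cell raises it. -/
lemma branch_le (hg : IsContractiveProfile g κ) (x : ℝ) {e e' : ℝ} (h : e ≤ e') :
    g (x - e) + e ≤ g (x - e') + e' := by
  have := hg.sub_le (x - e') (x - e) (by linarith)
  nlinarith [hg.lt_one]

lemma branch_lt (hg : IsContractiveProfile g κ) (x : ℝ) {e e' : ℝ} (h : e < e') :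
    g (x - e) + e < g (x - e') + e' := by
  have := hg.sub_le (x - e') (x - e) (by linarith)
  nlinarith [hg.lt_one]

end IsContractiveProfile

/-! ### Comparison principle -/

/-- The shift by l is a bijection of ℤ, so the supremum M of D satisfies M ≤ κ max(M, 0) + δ. The
bound B only ensures that M is finite. -/
lemma le_of_le_contraction {D : ℤ → ℝ} {l : ℕ} {κ δ B : ℝ} (hκ : 0 < κ) (hκ1 : κ < 1) (hδ : 0 ≤ δ)
    (hB : ∀ s, D s ≤ B) (hD : ∀ s, D (s + l) ≤ κ * max (D s) 0 + δ) (s : ℤ) :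
    D s ≤ δ / (1 - κ) := by
  have hbdd : BddAbove (range D) := ⟨B, by rintro _ ⟨s, rfl⟩; exact hB s⟩
  have h1 : ∀ s, D s ≤ κ * max (⨆ s, D s) 0 + δ := fun s => by
    have := hD (s - l)
    rw [sub_add_cancel] at this
    refine this.trans ?_
    gcongr
    exact le_ciSup hbdd _
  have h2 : (⨆ s, D s) ≤ κ * max (⨆ s, D s) 0 + δ := ciSup_le h1
  have h3 : D s ≤ ⨆ s, D s := le_ciSup hbdd s
  rw [le_div_iff₀ (by linarith)]
  rcases le_total 0 (⨆ s, D s) with h | h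
  · rw [max_eq_left h] at h2
    nlinarith
  · nlinarith

/-- Comparison principle for sub- and supersolutions of the orbit equation. -/
lemma IsContractiveProfile.sub_le_of_solutions {g : ℝ → ℝ} {κ : ℝ} (hg : IsContractiveProfile g κ)
    {l : ℕ} {P Q e e' : ℤ → ℝ} {d d' δ B : ℝ} (hB : ∀ s, P s - Q s ≤ B)
    (hP : ∀ s, P (s + l) ≤ g (P s - e s) + e s + d)
    (hQ : ∀ s, g (Q s - e' s) + e' s + d' ≤ Q (s + l))
    (he : ∀ s, e s ≤ e' s) (hδ : 0 ≤ δ) (hd : d ≤ d' + δ) (s : ℤ) :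
    P s - Q s ≤ δ / (1 - κ) := by
  refine le_of_le_contraction (D := fun s => P s - Q s) (l := l) hg.pos hg.lt_one hδ hB
    (fun s => ?_) s
  have h1 := hg.branch_le (P s) (he s)
  have h2 := hg.sub_le_max (P s - e' s) (Q s - e' s)
  rw [sub_sub_sub_cancel_right] at h2
  linarith [hP s, hQ s]

/-! ### Formal orbits: existence, monotonicity, dependence on the translation -/

/-- `P` is a bi-infinite family of points, ordered as an orbit with rotation number `l / n`, that is
carried to itself by the branches of the lift with profile `g` and translation `d`. -/
structure IsOrbit (g : ℝ → ℝ) (n l : ℕ) (d : ℝ) (P : ℤ → ℝ) : Prop where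
  bdd : ∃ B, ∀ s, |P s - s / n| ≤ B
  step : ∀ s, P (s + l) = g (P s - cell n s) + cell n s + d

/-- Since the cells are prescribed, the equation never sees the discontinuity. In the bounded
unknown u s = P s - s/n it is a fixed-point equation for a κ-contraction in the sup norm. -/
lemma exists_isOrbit {g : ℝ → ℝ} {κ : ℝ} (hg : IsContractiveProfile g κ) {n : ℕ} (hn : 0 < n)
    (l : ℕ) (d : ℝ) : ∃ P, IsOrbit g n l d P := by
  let step : (ℤ → ℝ) → ℤ → ℝ := fun u s =>
    g (u (s - l) + ((s - l : ℤ) : ℝ) / n - cell n (s - l)) + cell n (s - l) + d - s / n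
  have hn' : (0 : ℝ) < n := by exact_mod_cast hn
  have hlip : ∀ u v : ℤ → ℝ, ∀ s, |step u s - step v s| ≤ κ * |u (s - l) - v (s - l)| := by
    intro u v s
    have := hg.abs_sub_le (u (s - l) + ((s - l : ℤ) : ℝ) / n - cell n (s - l))
      (v (s - l) + ((s - l : ℤ) : ℝ) / n - cell n (s - l))
    simp only [step]
    convert this using 2 <;> ring_nf
  have h0 : ∀ s, |step 0 s| ≤ κ + 1 + l / n + |d| := by
    intro s
    have h1 := abs_cell_sub_le hn (s - l)
    have h2 := hg.abs_sub_le (((s - l : ℤ) : ℝ) / n - cell n (s - l)) 0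
    rw [hg.zero, sub_zero, sub_zero, abs_sub_comm] at h2
    have h3 : step 0 s = g (((s - l : ℤ) : ℝ) / n - cell n (s - l)) +
        (cell n (s - l) - ((s - l : ℤ) : ℝ) / n) + d - l / n := by
      simp only [step, Pi.zero_apply, zero_add]
      push_cast
      ring
    have h4 : (0 : ℝ) ≤ l / n := by positivity
    have h5 := neg_abs_le d
    have h6 := le_abs_self d
    have h7 := abs_le.1 h1
    have h8 : κ * |(cell n (s - l) : ℝ) - ((s - l : ℤ) : ℝ) / n| ≤ κ :=
      mul_le_of_le_one_right hg.pos.le h1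
    have h9 := abs_le.1 (h2.trans h8)
    rw [h3, abs_le]
    constructor <;> linarith [h7.1, h7.2, h9.1, h9.2]
  have hbdd : ∀ u : BoundedContinuousFunction ℤ ℝ, ∀ s,
      ‖step u s‖ ≤ κ * ‖u‖ + (κ + 1 + l / n + |d|) := by
    intro u s
    have h1 := hlip u 0 s
    rw [Pi.zero_apply, sub_zero] at h1
    have h2 : |u (s - l)| ≤ ‖u‖ := u.norm_coe_le_norm _
    have h3 := abs_sub_abs_le_abs_sub (step u s) (step 0 s)
    have h4 := mul_le_mul_of_nonneg_left h2 hg.pos.le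
    rw [Real.norm_eq_abs]
    linarith [h0 s]
  let Φ : BoundedContinuousFunction ℤ ℝ → BoundedContinuousFunction ℤ ℝ := fun u =>
    BoundedContinuousFunction.ofNormedAddCommGroupDiscrete (step u) _ (hbdd u)
  have hΦ : ContractingWith (NNReal.mk κ hg.pos.le) Φ := by
    refine ⟨by exact_mod_cast hg.lt_one, LipschitzWith.of_dist_le_mul fun u v => ?_⟩
    rw [BoundedContinuousFunction.dist_le (mul_nonneg (NNReal.coe_nonneg _) dist_nonneg)]
    intro s
    refine (hlip u v s).trans ?_
    rw [← Real.dist_eq]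
    exact mul_le_mul_of_nonneg_left (BoundedContinuousFunction.dist_coe_le_dist _) hg.pos.le
  obtain ⟨u, hu⟩ : ∃ u, Φ u = u := ⟨_, hΦ.fixedPoint_isFixedPt⟩
  refine ⟨fun s => u s + s / n, ⟨‖u‖, fun s => ?_⟩, fun s => ?_⟩
  · rw [add_sub_cancel_right]
    exact u.norm_coe_le_norm s
  · have h := congrArg (fun v : BoundedContinuousFunction ℤ ℝ => v (s + l)) hu
    have h' : step u (s + l) = u (s + l) := h
    rw [← h']
    simp only [step, add_sub_cancel_right]
    ring

lemma exists_nat_mul_add_mul {n l : ℕ} (hn : 0 < n) (h : Nat.Coprime n l) (s : ℤ) :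
    ∃ (k : ℕ) (m : ℤ), 0 < k ∧ s = k * l + m * n := by
  obtain ⟨u, v, huv⟩ := Nat.isCoprime_iff_coprime.2 h
  have h1 := Int.emod_add_mul_ediv (s * v) n
  have h2 := Int.emod_nonneg (s * v) (show (n : ℤ) ≠ 0 by omega)
  obtain ⟨k, hk⟩ := Int.eq_ofNat_of_zero_le h2
  -- Here k is the residue of s v mod n; adding n makes the first coefficient positive, and the -1
  -- in the second one compensates.
  refine ⟨k + n, s * u + (s * v / n - 1) * l, by omega, ?_⟩
  push_cast
  rw [← hk]
  linear_combination (-s) * huv - (l : ℤ) * h1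

namespace IsOrbit

variable {g : ℝ → ℝ} {κ : ℝ} {n l : ℕ} {d d' : ℝ} {P Q : ℤ → ℝ}

lemma exists_sub_le (hP : IsOrbit g n l d P) (hQ : IsOrbit g n l d' Q) :
    ∃ B, ∀ s, P s - Q s ≤ B := by
  obtain ⟨B, hB⟩ := hP.bdd
  obtain ⟨C, hC⟩ := hQ.bdd
  exact ⟨B + C, fun s => by linarith [(abs_le.1 (hB s)).2, (abs_le.1 (hC s)).1]⟩

/-- Comparison with defect |d - d'|. It yields uniqueness for d = d', and Lipschitz dependence on d
for the intermediate value argument. -/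
lemma sub_le_div (hg : IsContractiveProfile g κ) (hP : IsOrbit g n l d P)
    (hQ : IsOrbit g n l d' Q) (s : ℤ) : P s - Q s ≤ |d - d'| / (1 - κ) := by
  obtain ⟨B, hB⟩ := hP.exists_sub_le hQ
  exact hg.sub_le_of_solutions hB (fun s => (hP.step s).le) (fun s => (hQ.step s).ge)
    (fun _ => le_rfl) (abs_nonneg _) (by linarith [le_abs_self (d - d')]) s

lemma unique (hg : IsContractiveProfile g κ) (hP : IsOrbit g n l d P) (hQ : IsOrbit g n l d Q) :
    P = Q := by
  funext s
  have h1 := sub_le_div hg hP hQ s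
  have h2 := sub_le_div hg hQ hP s
  simp only [sub_self, abs_zero, zero_div] at h1 h2
  linarith

/-- Raising `P` by d' - d turns it into a subsolution for d'. Thus orbit points rise at least as
fast as the translation. -/
lemma add_sub_le (hg : IsContractiveProfile g κ) (hP : IsOrbit g n l d P)
    (hQ : IsOrbit g n l d' Q) (h : d ≤ d') (s : ℤ) : P s + (d' - d) ≤ Q s := by
  obtain ⟨B, hB⟩ := hP.exists_sub_le hQ
  have := hg.sub_le_of_solutions (l := l) (P := fun s => P s + (d' - d)) (Q := Q) (d := d')
    (d' := d') (δ := 0) (e := fun s => cell n s) (e' := fun s => cell n s) (B := B + (d' - d))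
    (fun s => by linarith [hB s])
    (fun s => ?_) (fun s => (hQ.step s).ge) (fun _ => le_rfl) le_rfl (by linarith) s
  · rw [zero_div] at this
    linarith
  · have : g (P s - cell n s) ≤ g (P s + (d' - d) - cell n s) :=
      hg.strictMono.monotone (by linarith)
    linarith [hP.step s]

/-- The shifted family P (s + n) - 1 solves the same equation, so uniqueness applies. -/
lemma add_n (hg : IsContractiveProfile g κ) (hn : 0 < n) (hP : IsOrbit g n l d P) (s : ℤ) :
    P (s + n) = P s + 1 := by
  have hn' : (n : ℝ) ≠ 0 := by positivity
  have : IsOrbit g n l d (fun s => P (s + n) - 1) := by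
    refine ⟨?_, fun s => ?_⟩
    · obtain ⟨B, hB⟩ := hP.bdd
      refine ⟨B, fun s => ?_⟩
      convert hB (s + n) using 2
      push_cast
      field_simp
      ring
    · rw [show s + (l : ℤ) + n = s + n + l by ring, hP.step, cell_add_self hn]
      push_cast
      rw [sub_sub, add_comm (cell n s : ℝ) 1]
      ring
  have := congrFun (unique hg hP this) s
  linarith

lemma add_mul_n (hg : IsContractiveProfile g κ) (hn : 0 < n) (hP : IsOrbit g n l d P) (s m : ℤ) :
    P (s + m * n) = P s + m := by
  induction m using Int.induction_on with
  | zero => simp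
  | succ i ih =>
    rw [show s + ((i : ℤ) + 1) * n = s + i * n + n by ring, hP.add_n hg hn, ih]
    push_cast
    ring
  | pred i ih =>
    have := hP.add_n hg hn (s + (-(i : ℤ) - 1) * n)
    rw [show s + (-(i : ℤ) - 1) * n + n = s + -(i : ℤ) * n by ring, ih] at this
    push_cast at *
    linarith

/-- The family shifted by one index solves the equation with cells at least as high, hence dominates
`P`. -/
lemma le_succ (hg : IsContractiveProfile g κ) (hP : IsOrbit g n l d P) (s : ℤ) :
    P s ≤ P (s + 1) := by
  obtain ⟨B, hB⟩ := hP.bdd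
  have := hg.sub_le_of_solutions (l := l) (P := P) (Q := fun s => P (s + 1)) (d := d)
    (d' := d) (δ := 0) (e := fun s => cell n s) (e' := fun s => cell n (s + 1)) (B := 2 * B)
    (fun s => ?_) (fun s => (hP.step s).le) (fun s => ?_) (fun s => ?_) le_rfl (by linarith) s
  · rw [zero_div] at this
    linarith
  · have h1 := (abs_le.1 (hB s)).2
    have h2 := (abs_le.1 (hB (s + 1))).1
    have h3 : (s : ℝ) / n ≤ ((s + 1 : ℤ) : ℝ) / n := by
      gcongr
      simp
    linarith
  · have := hP.step (s + 1)
    rw [show s + 1 + (l : ℤ) = s + l + 1 by ring] at this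
    exact this.ge
  · exact_mod_cast cell_mono n (by omega)

/-- The cell jumps between the indices 0 and 1, which makes the inequality strict at index l. Each
step adds l to the index and preserves strictness; by coprimality and periodicity this reaches every
index. -/
lemma strictMono (hg : IsContractiveProfile g κ) (hn : 0 < n) (hnl : Nat.Coprime n l)
    (hP : IsOrbit g n l d P) : StrictMono P := by
  have base : P l < P (l + 1) := by
    have h1 := hP.step 0
    have h2 := hP.step 1
    rw [zero_add] at h1
    rw [add_comm] at h2
    rw [h1, h2]
    have h3 : cell n 0 < cell n 1 := by
      rw [cell_eq_neg_one 0 (by omega) le_rfl, cell_eq_zero 1 (by omega) (by omega)]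
      norm_num
    have h4 := hg.branch_lt (P 0) (show (cell n 0 : ℝ) < cell n 1 by exact_mod_cast h3)
    have h5 : P 0 ≤ P 1 := hP.le_succ hg 0
    have h6 : g (P 0 - cell n 1) ≤ g (P 1 - cell n 1) := hg.strictMono.monotone (by linarith)
    linarith
  have step : ∀ s, P s < P (s + 1) → P (s + l) < P (s + l + 1) := by
    intro s hs
    rw [show s + (l : ℤ) + 1 = s + 1 + l by ring, hP.step, hP.step]
    have h4 := hg.branch_le (P s) (show (cell n s : ℝ) ≤ cell n (s + 1) by
      exact_mod_cast cell_mono n (by omega))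
    have h6 : g (P s - cell n (s + 1)) < g (P (s + 1) - cell n (s + 1)) :=
      hg.strictMono (by linarith)
    linarith
  have all : ∀ k : ℕ, P ((k + 1) * l) < P ((k + 1) * l + 1) := by
    intro k
    induction k with
    | zero => simpa using base
    | succ k ih =>
      have := step _ ih
      push_cast
      rwa [show ((k : ℤ) + 1 + 1) * l = (k + 1) * l + l by ring]
  refine strictMono_int_of_lt_succ fun s => ?_
  obtain ⟨k, m, hk, rfl⟩ := exists_nat_mul_add_mul hn hnl s
  obtain ⟨k, rfl⟩ := Nat.exists_eq_succ_of_ne_zero hk.ne'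
  rw [show ((k.succ : ℕ) : ℤ) * l + m * n + 1 = (k.succ * l + 1) + m * n by ring,
    hP.add_mul_n hg hn, hP.add_mul_n hg hn]
  have := all k
  push_cast
  linarith

end IsOrbit

/-- The orbit of the given combinatorial type passes through the origin, at any prescribed index,
for a suitable translation. -/
lemma exists_isOrbit_eq_zero {g : ℝ → ℝ} {κ : ℝ} (hg : IsContractiveProfile g κ) {n : ℕ}
    (hn : 0 < n) (l : ℕ) (s : ℤ) : ∃ d P, IsOrbit g n l d P ∧ P s = 0 := by
  choose P hP using exists_isOrbit hg hn l
  have hcont : Continuous fun d => P d s := by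
    have h1 : 0 < 1 - κ := by linarith [hg.lt_one]
    have : LipschitzWith (NNReal.mk (1 / (1 - κ)) (by positivity)) fun d => P d s :=
      LipschitzWith.of_dist_le_mul fun d d' => by
        have h1 := (hP d).sub_le_div hg (hP d') s
        have h2 := (hP d').sub_le_div hg (hP d) s
        rw [abs_sub_comm] at h2
        rw [Real.dist_eq, Real.dist_eq, NNReal.coe_mk, one_div_mul_eq_div]
        exact abs_le.2 ⟨by linarith, h1⟩
    exact this.continuous
  set p := P 0 s with hp
  have h1 : P (-|p|) s ≤ 0 := by
    have := (hP (-|p|)).add_sub_le hg (hP 0) (by simp) s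
    linarith [le_abs_self p]
  have h2 : 0 ≤ P |p| s := by
    have := (hP 0).add_sub_le hg (hP |p|) (by simp) s
    linarith [neg_abs_le p]
  obtain ⟨d, -, hd⟩ := intermediate_value_Icc (f := fun d => P d s)
    (show -|p| ≤ |p| by linarith [abs_nonneg p]) hcont.continuousOn ⟨h1, h2⟩
  exact ⟨d, P d, hP d, hd⟩

/-! ### The lift and the gap in its image -/

/-- The lift to the line of the circle map `x ↦ g x + d (mod 1)` of `[0,1)`. -/
noncomputable def lift (g : ℝ → ℝ) (d x : ℝ) : ℝ := g (Int.fract x) + ⌊x⌋ + d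

lemma lift_add_int (g : ℝ → ℝ) (d x : ℝ) (m : ℤ) : lift g d (x + m) = lift g d x + m := by
  simp only [lift, Int.fract_add_intCast, Int.floor_add_intCast]
  push_cast
  ring

lemma iterate_lift_add_int (g : ℝ → ℝ) (d x : ℝ) (m : ℤ) (k : ℕ) :
    (lift g d)^[k] (x + m) = (lift g d)^[k] x + m := by
  induction k with
  | zero => rfl
  | succ k ih =>
    rw [Function.iterate_succ_apply', ih, lift_add_int, Function.iterate_succ_apply' (f := lift g d)]

namespace IsContractiveProfile

variable {g : ℝ → ℝ} {κ : ℝ}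

/-- At integers the lift jumps upwards, because g 1 < 1 + g 0. -/
lemma strictMono_lift (hg : IsContractiveProfile g κ) (d : ℝ) : StrictMono (lift g d) := by
  intro x y hxy
  unfold lift
  rcases (Int.floor_mono hxy.le).eq_or_lt with h | h
  · rw [h]
    have : Int.fract x < Int.fract y := by
      rw [Int.fract, Int.fract, h]
      linarith
    linarith [hg.strictMono this]
  · have h1 := hg.strictMono (Int.fract_lt_one x)
    have h2 := hg.strictMono.monotone (Int.fract_nonneg y)
    have h3 : (⌊x⌋ : ℝ) + 1 ≤ ⌊y⌋ := by exact_mod_cast h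
    linarith [hg.one_lt, hg.zero]

lemma lift_zero (hg : IsContractiveProfile g κ) (d : ℝ) : lift g d 0 = d := by
  simp [lift, hg.zero]

lemma le_lift (hg : IsContractiveProfile g κ) (d : ℝ) {x : ℝ} {m : ℤ} (h : m ≤ x) :
    d + m ≤ lift g d x := by
  have h1 := (hg.strictMono_lift d).monotone h
  have h2 := lift_add_int g d 0 m
  rw [zero_add, hg.lift_zero] at h2
  linarith

lemma lift_lt (hg : IsContractiveProfile g κ) (d : ℝ) {x : ℝ} {m : ℤ} (h : x < m) :
    lift g d x < g 1 - 1 + d + m := by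
  have h1 := hg.strictMono (Int.fract_lt_one x)
  have h2 : (⌊x⌋ : ℝ) + 1 ≤ m := by exact_mod_cast Int.floor_lt.2 h
  unfold lift
  linarith

lemma lift_sub_le (hg : IsContractiveProfile g κ) (d : ℝ) {x y : ℝ} (hxy : x ≤ y)
    (h : ⌊x⌋ = ⌊y⌋) : lift g d y - lift g d x ≤ κ * (y - x) := by
  have h1 : Int.fract y - Int.fract x = y - x := by
    rw [Int.fract, Int.fract, h]
    ring
  have := hg.sub_le (Int.fract x) (Int.fract y) (by linarith)
  rw [h1] at this
  unfold lift
  rw [h]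
  linarith

/-- One period of the lift covers [d, d + g 1), which leaves [g 1 - 1 + d, d) modulo 1. -/
lemma exists_lift_eq_or_mem_gap (hg : IsContractiveProfile g κ) (d y : ℝ) :
    (∃ x, lift g d x = y) ∨ ∃ m : ℤ, y - m ∈ Ico (g 1 - 1 + d) d := by
  have h0 := Int.fract_nonneg (y - d)
  have h1 := Int.fract_lt_one (y - d)
  have h2 := Int.floor_add_fract (y - d)
  rcases lt_or_ge (Int.fract (y - d)) (g 1) with h | h
  · left
    obtain ⟨x, hx, hx'⟩ := intermediate_value_Icc zero_le_one hg.continuous.continuousOn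
      ⟨hg.zero.trans_le h0, h.le⟩
    have hx1 : x < 1 := hg.strictMono.lt_iff_lt.1 (hx'.trans_lt h)
    refine ⟨x + ⌊y - d⌋, ?_⟩
    rw [lift_add_int, lift, Int.fract_eq_self.2 ⟨hx.1, hx1⟩, Int.floor_eq_zero_iff.2 ⟨hx.1, hx1⟩,
      hx']
    push_cast
    linarith
  · right
    refine ⟨⌊y - d⌋ + 1, ?_, ?_⟩ <;> push_cast <;> linarith

end IsContractiveProfile

/-! ### Mode locking: the formal orbit as a true orbit -/

/-- The lift with profile `g` and translation `d` is mode-locked at the rotation number `l / n`, in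
the interior of the locking interval: it has a periodic orbit `P`, and the discontinuity lies
strictly between two consecutive points of `P`. The point `q` is the preimage of the discontinuity
in the gap of the image. -/
structure IsLocked (g : ℝ → ℝ) (κ : ℝ) (n l : ℕ) (d : ℝ) (P : ℤ → ℝ) (q : ℝ) : Prop where
  profile : IsContractiveProfile g κ
  two_le : 2 ≤ n
  coprime : Nat.Coprime n l
  orbit : IsOrbit g n l d P
  neg : P 0 < 0
  pos : 0 < P 1
  lt_q : g 1 - 1 + d < q
  q_lt : q < d
  iterate_q : (lift g d)^[n - 1] q = l

section Orbit

variable {g : ℝ → ℝ} {κ : ℝ} {n l : ℕ} {d : ℝ} {P : ℤ → ℝ}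

/-- Subtracting the cell brings the index into 1, …, n, and P n = P 0 + 1. -/
lemma IsOrbit.sub_cell_mem (hg : IsContractiveProfile g κ) (hn : 0 < n) (hnl : Nat.Coprime n l)
    (hP : IsOrbit g n l d P) (s : ℤ) : P s - cell n s ∈ Icc (P 1) (P 0 + 1) := by
  have hmono := (hP.strictMono hg hn hnl).monotone
  have e := hP.add_mul_n hg hn (s - cell n s * n) (cell n s)
  rw [sub_add_cancel] at e
  have e1 := hP.add_n hg hn 0
  have m1 := Int.emod_add_mul_ediv (s - 1) n
  have m2 := Int.emod_nonneg (s - 1) (show (n : ℤ) ≠ 0 by omega)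
  have m3 := Int.emod_lt_of_pos (s - 1) (show (0 : ℤ) < n by omega)
  have m4 : s - cell n s * n = (s - 1) % n + 1 := by
    unfold cell
    linarith
  have a1 : P 1 ≤ P (s - cell n s * n) := hmono (by omega)
  have a2 : P (s - cell n s * n) ≤ P (0 + n) := hmono (by omega)
  constructor <;> linarith

lemma IsOrbit.floor_eq (hg : IsContractiveProfile g κ) (hn : 2 ≤ n) (hnl : Nat.Coprime n l)
    (hP : IsOrbit g n l d P) (h0 : P 0 < 0) (h1 : 0 < P 1) (s : ℤ) : ⌊P s⌋ = cell n s := by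
  have h := hP.sub_cell_mem hg (by omega) hnl s
  rw [Int.floor_eq_iff]
  constructor <;> linarith [h.1, h.2]

lemma IsOrbit.lift_eq (hg : IsContractiveProfile g κ) (hn : 2 ≤ n) (hnl : Nat.Coprime n l)
    (hP : IsOrbit g n l d P) (h0 : P 0 < 0) (h1 : 0 < P 1) (s : ℤ) :
    lift g d (P s) = P (s + l) := by
  rw [hP.step, lift, Int.fract, hP.floor_eq hg hn hnl h0 h1]

lemma IsOrbit.iterate_lift_eq (hg : IsContractiveProfile g κ) (hn : 2 ≤ n)
    (hnl : Nat.Coprime n l) (hP : IsOrbit g n l d P) (h0 : P 0 < 0) (h1 : 0 < P 1) (s : ℤ)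
    (k : ℕ) : (lift g d)^[k] (P s) = P (s + k * l) := by
  induction k with
  | zero => simp
  | succ k ih =>
    rw [Function.iterate_succ_apply', ih, hP.lift_eq hg hn hnl h0 h1]
    congr 1
    push_cast
    ring

lemma IsOrbit.floor_eq_of_mem (hg : IsContractiveProfile g κ) (hn : 2 ≤ n)
    (hnl : Nat.Coprime n l) (hP : IsOrbit g n l d P) (h0 : P 0 < 0) (h1 : 0 < P 1) {s : ℤ}
    (hs : ¬ (n : ℤ) ∣ s) {x : ℝ} (hx : x ∈ Icc (P s) (P (s + 1))) : ⌊x⌋ = cell n s := by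
  have a1 := Int.floor_mono hx.1
  have a2 := Int.floor_mono hx.2
  rw [hP.floor_eq hg hn hnl h0 h1] at a1 a2
  rw [cell_succ_of_not_dvd (by omega) hs] at a2
  exact le_antisymm a2 a1

lemma IsOrbit.exists_lift_eq (hg : IsContractiveProfile g κ) (hn : 2 ≤ n)
    (hnl : Nat.Coprime n l) (hP : IsOrbit g n l d P) (h0 : P 0 < 0) (h1 : 0 < P 1) {s : ℤ}
    (hs : ¬ (n : ℤ) ∣ s) {y : ℝ} (hy : y ∈ Icc (P (s + l)) (P (s + l + 1))) :
    ∃ x ∈ Icc (P s) (P (s + 1)), lift g d x = y := by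
  have hle : P s ≤ P (s + 1) := hP.le_succ hg s
  have hc : Continuous fun x => g (x - cell n s) + cell n s + d := by
    have := hg.continuous
    fun_prop
  rw [show s + (l : ℤ) + 1 = s + 1 + l by ring, hP.step, hP.step,
    cell_succ_of_not_dvd (by omega) hs] at hy
  obtain ⟨x, hx, hxy⟩ := intermediate_value_Icc hle hc.continuousOn hy
  refine ⟨x, hx, ?_⟩
  rw [← hxy, lift, Int.fract, hP.floor_eq_of_mem hg hn hnl h0 h1 hs hx]

lemma not_dvd_mul_of_coprime (hnl : Nat.Coprime n l) {i : ℕ} (h0 : 0 < i) (h1 : i < n) :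
    ¬ (n : ℤ) ∣ i * l := by
  intro h
  have : n ∣ i := hnl.dvd_of_dvd_mul_right (by exact_mod_cast h)
  exact absurd (Nat.le_of_dvd h0 this) (by omega)

/-- Going back from the arc of index n l, the arcs met have index j l with 0 < j < n. None contains
a discontinuity, so the lift maps each continuously onto the next. -/
lemma IsOrbit.exists_iterate_lift_eq (hg : IsContractiveProfile g κ) (hn : 2 ≤ n)
    (hnl : Nat.Coprime n l) (hP : IsOrbit g n l d P) (h0 : P 0 < 0) (h1 : 0 < P 1) {y : ℝ}
    (hy : y ∈ Icc (P (n * l)) (P (n * l + 1))) (i : ℕ) (hi : i < n) :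
    ∃ x ∈ Icc (P ((n - i : ℕ) * l)) (P ((n - i : ℕ) * l + 1)), (lift g d)^[i] x = y := by
  induction i with
  | zero => exact ⟨y, by simpa using hy, rfl⟩
  | succ i ih =>
    obtain ⟨x, hx, hxy⟩ := ih (by omega)
    have e : ((n - i : ℕ) : ℤ) * l = (n - (i + 1) : ℕ) * l + l := by
      rw [show n - i = n - (i + 1) + 1 by omega]
      push_cast
      ring
    rw [e] at hx
    obtain ⟨z, hz, hzx⟩ := hP.exists_lift_eq hg hn hnl h0 h1
      (not_dvd_mul_of_coprime hnl (i := n - (i + 1)) (by omega) (by omega)) hx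
    exact ⟨z, hz, by rw [Function.iterate_succ_apply, hzx, hxy]⟩

lemma IsOrbit.iterate_lift_mem (hg : IsContractiveProfile g κ) (hn : 2 ≤ n)
    (hnl : Nat.Coprime n l) (hP : IsOrbit g n l d P) (h0 : P 0 < 0) (h1 : 0 < P 1) {s : ℤ}
    {y : ℝ} (hy : y ∈ Icc (P s) (P (s + 1))) (k : ℕ) :
    (lift g d)^[k] y ∈ Icc (P (s + k * l)) (P (s + k * l + 1)) := by
  have hm := ((hg.strictMono_lift d).iterate k).monotone
  rw [← hP.iterate_lift_eq hg hn hnl h0 h1, add_right_comm, ← hP.iterate_lift_eq hg hn hnl h0 h1]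
  exact ⟨hm hy.1, hm hy.2⟩

/-- Distances to the ends of an arc of the orbit do not grow until the arc returns to the
discontinuity. -/
lemma IsOrbit.iterate_lift_sub_le (hg : IsContractiveProfile g κ) (hn : 2 ≤ n)
    (hnl : Nat.Coprime n l) (hP : IsOrbit g n l d P) (h0 : P 0 < 0) (h1 : 0 < P 1) {y : ℝ}
    (hy : y ∈ Icc (P l) (P (l + 1))) (i : ℕ) (hi : i < n) :
    (lift g d)^[i] y - P (l + i * l) ≤ y - P l ∧
      P (l + i * l + 1) - (lift g d)^[i] y ≤ P (l + 1) - y := by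
  induction i with
  | zero => simp
  | succ i ih =>
    have ih := ih (by omega)
    have hx := hP.iterate_lift_mem hg hn hnl h0 h1 hy i
    have hs := not_dvd_mul_of_coprime hnl (i := i + 1) (by omega) hi
    rw [show ((i + 1 : ℕ) : ℤ) * l = l + i * l by push_cast; ring] at hs
    have f := fun x hx => hP.floor_eq_of_mem hg hn hnl h0 h1 hs (x := x) hx
    have hle : P (l + i * l) ≤ P (l + i * l + 1) := hP.le_succ hg _
    have a1 := hg.lift_sub_le d hx.1 (by rw [f _ hx, f _ ⟨le_rfl, hle⟩])
    have a2 := hg.lift_sub_le d hx.2 (by rw [f _ hx, f _ ⟨hle, le_rfl⟩])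
    rw [hP.lift_eq hg hn hnl h0 h1] at a1 a2
    rw [Function.iterate_succ_apply']
    have e : (l : ℤ) + (i + 1 : ℕ) * l = l + i * l + l := by push_cast; ring
    rw [e, show (l : ℤ) + i * l + l + 1 = l + i * l + 1 + l by ring]
    have b1 : κ * ((lift g d)^[i] y - P (l + i * l)) ≤ (lift g d)^[i] y - P (l + i * l) :=
      mul_le_of_le_one_left (sub_nonneg.2 hx.1) hg.lt_one.le
    have b2 : κ * (P (l + i * l + 1) - (lift g d)^[i] y) ≤ P (l + i * l + 1) - (lift g d)^[i] y :=
      mul_le_of_le_one_left (sub_nonneg.2 hx.2) hg.lt_one.le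
    constructor <;> linarith

lemma IsOrbit.sub_lift_zero_le (hg : IsContractiveProfile g κ) (hn : 2 ≤ n)
    (hP : IsOrbit g n l d P) {x : ℝ} (hx : 0 ≤ x) (hx1 : x ≤ P 1) (h1 : P 1 < 1) :
    P (l + 1) - lift g d x ≤ κ * (P 1 - x) := by
  have e := hP.step 1
  have hf : ⌊P 1⌋ = 0 := Int.floor_eq_zero_iff.2 ⟨by linarith, h1⟩
  have hf' : ⌊x⌋ = 0 := Int.floor_eq_zero_iff.2 ⟨hx, by linarith⟩
  have := hg.lift_sub_le d hx1 (by rw [hf, hf'])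
  have e' : lift g d (P 1) = P (1 + l) := by
    rw [e, lift, Int.fract, hf, cell_eq_zero 1 (by omega) (by omega)]
  rw [add_comm, ← e']
  exact this

lemma IsOrbit.gap_sub_le (hg : IsContractiveProfile g κ) (hn : 2 ≤ n) (hP : IsOrbit g n l d P)
    (h0 : P 0 < 0) : P l < g 1 - 1 + d ∧ g 1 - 1 + d - P l ≤ κ * (0 - P 0) := by
  have e := hP.step 0
  rw [zero_add, cell_eq_neg_one 0 (by omega) le_rfl] at e
  push_cast at e
  have a := hg.sub_le (P 0 - -1) 1 (by linarith)
  have b := hg.strictMono (show P 0 - -1 < 1 by linarith)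
  constructor <;> linarith

/-- The point q is obtained by pulling the discontinuity l back n - 1 steps through continuous arcs.
The lower end of the gap is within κ|P 0| of P l, and n - 1 nonexpanding steps keep it less than |P
0| above P 0 + l, hence below l. Symmetrically the upper end d lands above l, so q lies strictly
inside the gap. -/
lemma IsOrbit.exists_isLocked (hg : IsContractiveProfile g κ) (hn : 2 ≤ n)
    (hnl : Nat.Coprime n l) (hP : IsOrbit g n l d P) (h0 : P 0 < 0) (h1 : 0 < P 1) :
    ∃ q, IsLocked g κ n l d P q := by
  have hn0 : 0 < n := by omega
  have hmono := hP.strictMono hg hn0 hnl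
  have e0 := hP.add_mul_n hg hn0 0 l
  have e1 := hP.add_mul_n hg hn0 1 l
  have e2 := hP.add_n hg hn0 0
  have h1' : P 1 < 1 := by
    have : P 1 < P (0 + n) := hmono (by omega)
    linarith
  have hnl0 : (0 : ℤ) + l * n = n * l := by ring
  have hnl1 : (1 : ℤ) + l * n = n * l + 1 := by ring
  rw [hnl0] at e0
  rw [hnl1] at e1
  push_cast at e0 e1
  obtain ⟨q, -, hq'⟩ := hP.exists_iterate_lift_eq hg hn hnl h0 h1 (y := l)
    ⟨by linarith, by linarith⟩ (n - 1) (by omega)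
  obtain ⟨g1, g2⟩ := hP.gap_sub_le hg hn h0
  have g3 := hP.sub_lift_zero_le hg hn le_rfl h1.le h1'
  rw [hg.lift_zero] at g3
  have g4 : d < P (l + 1) := by
    have := hg.strictMono_lift d h1
    rwa [hg.lift_zero, hP.lift_eq hg hn hnl h0 h1, add_comm] at this
  have g5 : g 1 - 1 + d < d := by linarith [hg.one_lt]
  have hi := (hg.strictMono_lift d).iterate (n - 1)
  have ei : (l : ℤ) + (n - 1 : ℕ) * l = n * l := by
    rw [Nat.cast_sub (by omega)]
    push_cast
    ring
  have k1 : κ * (0 - P 0) < 0 - P 0 := mul_lt_of_lt_one_left (by linarith) hg.lt_one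
  have k2 : κ * (P 1 - 0) < P 1 - 0 := mul_lt_of_lt_one_left (by linarith) hg.lt_one
  have c1 := hP.iterate_lift_sub_le hg hn hnl h0 h1 (y := g 1 - 1 + d)
    ⟨by linarith, by linarith⟩ (n - 1) (by omega)
  have c2 := hP.iterate_lift_sub_le hg hn hnl h0 h1 (y := d)
    ⟨by linarith, by linarith⟩ (n - 1) (by omega)
  rw [ei] at c1 c2
  refine ⟨q, hg, hn, hnl, hP, h0, h1, hi.lt_iff_lt.1 ?_, hi.lt_iff_lt.1 ?_, hq'⟩ <;> rw [hq']
  · linarith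
  · linarith

end Orbit

/-! ### Addresses and their order -/

/-- Symbolic names `(k, m, t)` of points of the line: the image, under `k` steps of the lift and
translation by `m`, of the point with parameter `t` in the gap, or of the periodic point below it
when `t = ⊥`. -/
abbrev Address := ℕ × ℤ × WithBot (Ico (-1 : ℝ) 1)

/-- Position, within an arc of the periodic orbit, of the `k`-th image of the gap. -/
noncomputable def arcPosition (k : ℕ) (t : Ico (-1 : ℝ) 1) : ℝ :=
  -- Later images of the part of the gap left of q lie further to the left in the arc, those of the
  -- right part further to the right. The shifts by k place them in disjoint unit intervals in that
  -- order.
  if (t : ℝ) < 0 then t - k else t + k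

/-- The order type of an address, for rotation number `l / n`. -/
noncomputable def Address.key (n l : ℕ) (a : Address) : ℤ ×ₗ WithBot ℝ :=
  toLex (a.1 * l + a.2.1 * n, a.2.2.map (arcPosition a.1))

/-- The point of the gap `[u, v)` with parameter `t`, where `q` has parameter `0`. -/
noncomputable def gapPoint (u q v : ℝ) (t : ℝ) : ℝ :=
  if t < 0 then q + t * (q - u) else q + t * (v - q)

lemma gapPoint_mem {u q v t : ℝ} (hu : u < q) (hv : q < v) (ht : t ∈ Ico (-1 : ℝ) 1) :
    gapPoint u q v t ∈ Ico u v := by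
  obtain ⟨h1, h2⟩ := ht
  unfold gapPoint
  split_ifs with h
  · constructor <;> nlinarith
  · constructor <;> nlinarith

lemma gapPoint_lt_of_neg {u q v t : ℝ} (hu : u < q) (ht : t < 0) : gapPoint u q v t < q := by
  unfold gapPoint
  rw [if_pos ht]
  nlinarith

lemma le_gapPoint_of_nonneg {u q v t : ℝ} (hv : q < v) (ht : 0 ≤ t) : q ≤ gapPoint u q v t := by
  unfold gapPoint
  rw [if_neg ht.not_gt]
  nlinarith

lemma gapPoint_strictMono {u q v : ℝ} (hu : u < q) (hv : q < v) : StrictMono (gapPoint u q v) := by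
  intro s t hst
  unfold gapPoint
  split_ifs <;> nlinarith

lemma exists_gapPoint_eq {u q v x : ℝ} (hu : u < q) (hv : q < v) (hx : x ∈ Ico u v) :
    ∃ t ∈ Ico (-1 : ℝ) 1, gapPoint u q v t = x := by
  obtain ⟨h1, h2⟩ := hx
  have h3 : 0 < q - u := by linarith
  have h4 : 0 < v - q := by linarith
  rcases lt_or_ge x q with h | h
  · have h5 : (x - q) / (q - u) < 0 := div_neg_of_neg_of_pos (by linarith) h3
    refine ⟨(x - q) / (q - u), ⟨?_, by linarith⟩, ?_⟩
    · rw [le_div_iff₀ h3]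
      linarith
    · rw [gapPoint, if_pos h5]
      field_simp
      ring
  · have h5 : 0 ≤ (x - q) / (v - q) := div_nonneg (by linarith) h4.le
    refine ⟨(x - q) / (v - q), ⟨by linarith, ?_⟩, ?_⟩
    · rw [div_lt_one h4]
      linarith
    · rw [gapPoint, if_neg h5.not_gt]
      field_simp
      ring

/-- The point with a given parameter: in the gap, or the periodic point below it. -/
noncomputable def basePoint (g : ℝ → ℝ) (l : ℕ) (d : ℝ) (P : ℤ → ℝ) (q : ℝ) :
    WithBot (Ico (-1 : ℝ) 1) → ℝ
  | ⊥ => P l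
  | (t : Ico (-1 : ℝ) 1) => gapPoint (g 1 - 1 + d) q d t

/-- The point of the line with a given address. -/
noncomputable def Address.point (g : ℝ → ℝ) (l : ℕ) (d : ℝ) (P : ℤ → ℝ) (q : ℝ) (a : Address) :
    ℝ :=
  (lift g d)^[a.1] (basePoint g l d P q a.2.2) + a.2.1

namespace IsLocked

variable {g : ℝ → ℝ} {κ : ℝ} {n l : ℕ} {d : ℝ} {P : ℤ → ℝ} {q : ℝ}

lemma lift_eq (h : IsLocked g κ n l d P q) (s : ℤ) : lift g d (P s) = P (s + l) :=
  h.orbit.lift_eq h.profile h.two_le h.coprime h.neg h.pos s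

lemma iterate_lift_eq (h : IsLocked g κ n l d P q) (s : ℤ) (k : ℕ) :
    (lift g d)^[k] (P s) = P (s + k * l) :=
  h.orbit.iterate_lift_eq h.profile h.two_le h.coprime h.neg h.pos s k

lemma n_pos (h : IsLocked g κ n l d P q) : 0 < n := by
  have := h.two_le
  omega

lemma strictMono (h : IsLocked g κ n l d P q) : StrictMono P :=
  h.orbit.strictMono h.profile h.n_pos h.coprime

lemma add_mul_n (h : IsLocked g κ n l d P q) (s m : ℤ) : P (s + m * n) = P s + m :=
  h.orbit.add_mul_n h.profile h.n_pos s m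

lemma strictMono_iterate (h : IsLocked g κ n l d P q) (k : ℕ) : StrictMono (lift g d)^[k] :=
  (h.profile.strictMono_lift d).iterate k

lemma lt_gap (h : IsLocked g κ n l d P q) : P l < g 1 - 1 + d :=
  (h.orbit.gap_sub_le h.profile h.two_le h.neg).1

lemma gap_lt (h : IsLocked g κ n l d P q) : d < P (l + 1) := by
  have := h.profile.strictMono_lift d h.pos
  rwa [h.profile.lift_zero, h.lift_eq, add_comm] at this

/-- A point left of q is left of the discontinuity l after n - 1 steps, so the next step puts it
below the gap translated by l. It is then again left of q + l, and the argument repeats. -/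
lemma iterate_lt_of_lt_q (h : IsLocked g κ n l d P q) (i : ℕ) {y : ℝ} (hy : y < q) :
    (lift g d)^[n * (i + 1)] y < g 1 - 1 + d + (i + 1) * l := by
  have base : ∀ y < q, (lift g d)^[n] y < g 1 - 1 + d + l := by
    intro y hy
    have := h.strictMono_iterate (n - 1) hy
    rw [h.iterate_q] at this
    have := h.profile.lift_lt d (m := l) (by exact_mod_cast this)
    rw [← Function.iterate_succ_apply' (lift g d), Nat.succ_eq_add_one, Nat.sub_add_cancel h.n_pos] at this
    exact_mod_cast this
  induction i generalizing y with
  | zero => simpa using base y hy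
  | succ i ih =>
    have h1 := base y hy
    have h2 := ih (y := (lift g d)^[n] y - l) (by linarith [h.lt_q])
    rw [show n * (i + 1 + 1) = n * (i + 1) + n by ring, Function.iterate_add_apply]
    have h3 := iterate_lift_add_int g d ((lift g d)^[n] y - l) l (n * (i + 1))
    push_cast at h3 ⊢
    rw [sub_add_cancel] at h3
    linarith

lemma le_iterate_of_q_le (h : IsLocked g κ n l d P q) (i : ℕ) {y : ℝ} (hy : q ≤ y) :
    d + (i + 1) * l ≤ (lift g d)^[n * (i + 1)] y := by
  have base : ∀ y, q ≤ y → d + l ≤ (lift g d)^[n] y := by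
    intro y hy
    have := (h.strictMono_iterate (n - 1)).monotone hy
    rw [h.iterate_q] at this
    have := h.profile.le_lift d (m := l) (by exact_mod_cast this)
    rw [← Function.iterate_succ_apply' (lift g d), Nat.succ_eq_add_one, Nat.sub_add_cancel h.n_pos] at this
    exact_mod_cast this
  induction i generalizing y with
  | zero => simpa using base y hy
  | succ i ih =>
    have h1 := base y hy
    have h2 := ih (y := (lift g d)^[n] y - l) (by linarith [h.q_lt])
    rw [show n * (i + 1 + 1) = n * (i + 1) + n by ring, Function.iterate_add_apply]
    have h3 := iterate_lift_add_int g d ((lift g d)^[n] y - l) l (n * (i + 1))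
    push_cast at h3 ⊢
    rw [sub_add_cancel] at h3
    linarith

lemma basePoint_mem (h : IsLocked g κ n l d P q) (t : WithBot (Ico (-1 : ℝ) 1)) :
    basePoint g l d P q t ∈ Ico (P l) (P (l + 1)) := by
  cases t with
  | bot => exact ⟨le_rfl, h.strictMono (by omega)⟩
  | coe t =>
    have := gapPoint_mem h.lt_q h.q_lt t.2
    exact ⟨h.lt_gap.le.trans this.1, this.2.trans h.gap_lt⟩

/-- The gap lies in the arc from P l to P (l + 1), and iterates carry arcs monotonically into arcs.
Hence the first component of the key determines the arc. -/
lemma point_mem (h : IsLocked g κ n l d P q) (a : Address) :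
    a.point g l d P q ∈ Ico (P (l + (a.1 * l + a.2.1 * n))) (P (l + (a.1 * l + a.2.1 * n) + 1)) := by
  obtain ⟨k, m, t⟩ := a
  have hb := h.basePoint_mem t
  have e1 := h.add_mul_n (l + k * l) m
  have e2 := h.add_mul_n (l + 1 + k * l) m
  rw [← h.iterate_lift_eq] at e1 e2
  have h1 := (h.strictMono_iterate k).monotone hb.1
  have h2 := h.strictMono_iterate k hb.2
  rw [show (l : ℤ) + (k * l + m * n) = l + k * l + m * n by ring,
    show (l : ℤ) + k * l + m * n + 1 = l + 1 + k * l + m * n by ring, e1, e2]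
  simp only [Address.point]
  constructor <;> linarith

lemma point_bot (h : IsLocked g κ n l d P q) (k : ℕ) (m : ℤ) :
    Address.point g l d P q (k, m, ⊥) = P (l + (k * l + m * n)) := by
  rw [show (l : ℤ) + (k * l + m * n) = l + k * l + m * n by ring, h.add_mul_n, ← h.iterate_lift_eq]
  rfl

lemma lt_point_coe (h : IsLocked g κ n l d P q) (k : ℕ) (m : ℤ) (t : Ico (-1 : ℝ) 1) :
    P (l + (k * l + m * n)) < Address.point g l d P q (k, m, (t : WithBot _)) := by
  rw [← h.point_bot]
  have : P l < gapPoint (g 1 - 1 + d) q d t :=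
    h.lt_gap.trans_le (gapPoint_mem h.lt_q h.q_lt t.2).1
  have := h.strictMono_iterate k this
  simp only [Address.point, basePoint]
  linarith

/-- Two iterates of the gap lie in the same arc only if their times differ by a multiple of n, by
coprimality. -/
lemma exists_eq_add_mul (h : IsLocked g κ n l d P q) {k k' : ℕ} {m m' : ℤ} (hk : k < k')
    (hs : (k : ℤ) * l + m * n = k' * l + m' * n) :
    ∃ i : ℕ, k' = k + n * (i + 1) ∧ m = m' + (i + 1) * l := by
  have h1 : (n : ℤ) ∣ ((k' - k : ℕ) : ℤ) * l := by
    rw [Nat.cast_sub hk.le]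
    exact ⟨m - m', by linarith⟩
  have h2 : n ∣ k' - k := h.coprime.dvd_of_dvd_mul_right (by exact_mod_cast h1)
  obtain ⟨j, hj⟩ := h2
  have hj0 : j ≠ 0 := by
    rintro rfl
    omega
  obtain ⟨i, rfl⟩ := Nat.exists_eq_succ_of_ne_zero hj0
  have e : k' = k + n * (i + 1) := by
    rw [Nat.succ_eq_add_one] at hj
    omega
  refine ⟨i, e, ?_⟩
  have hn : (n : ℤ) ≠ 0 := by
    have := h.n_pos
    omega
  apply mul_right_cancel₀ hn
  rw [e] at hs
  push_cast at hs
  linarith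

lemma arcPosition_lt_of_neg {k k' : ℕ} (hk : k < k') (t t' : Ico (-1 : ℝ) 1)
    (ht' : (t' : ℝ) < 0) : arcPosition k' t' < arcPosition k t := by
  have h1 : (k : ℝ) + 1 ≤ k' := by exact_mod_cast hk
  have h2 := t.2.1
  have h3 : (0 : ℝ) ≤ k := k.cast_nonneg
  unfold arcPosition
  rw [if_pos ht']
  split_ifs <;> linarith

lemma arcPosition_lt_of_nonneg {k k' : ℕ} (hk : k < k') (t t' : Ico (-1 : ℝ) 1)
    (ht' : 0 ≤ (t' : ℝ)) : arcPosition k t < arcPosition k' t' := by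
  have h1 : (k : ℝ) + 1 ≤ k' := by exact_mod_cast hk
  have h2 := t.2.2
  have h3 : (0 : ℝ) ≤ k := k.cast_nonneg
  unfold arcPosition
  rw [if_neg ht'.not_gt]
  split_ifs <;> linarith

lemma arcPosition_strictMono (k : ℕ) : StrictMono (arcPosition k) := by
  intro t t' htt'
  have h1 : (t : ℝ) < t' := htt'
  have h3 : (0 : ℝ) ≤ k := k.cast_nonneg
  unfold arcPosition
  split_ifs <;> linarith

lemma point_lt_of_key_lt (h : IsLocked g κ n l d P q) {a b : Address}
    (hab : a.key n l < b.key n l) : a.point g l d P q < b.point g l d P q := by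
  rw [Address.key, Address.key, Prod.Lex.toLex_lt_toLex] at hab
  rcases hab with hs | ⟨hs, ht⟩
  · exact ((h.point_mem a).2.trans_le (h.strictMono.monotone (by simp only at hs; omega))).trans_le
      (h.point_mem b).1
  · obtain ⟨k, m, t⟩ := a
    obtain ⟨k', m', t'⟩ := b
    simp only at hs ht
    cases t' with
    | bot => simp at ht
    | coe t' =>
      cases t with
      | bot =>
        rw [h.point_bot, hs]
        exact h.lt_point_coe k' m' t'
      | coe t =>
        rw [WithBot.map_coe, WithBot.map_coe, WithBot.coe_lt_coe] at ht
        simp only [Address.point, basePoint]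
        have mt := gapPoint_mem h.lt_q h.q_lt t.2
        have mt' := gapPoint_mem h.lt_q h.q_lt t'.2
        rcases lt_trichotomy k k' with hk | rfl | hk
        -- The later point comes from the right half, since a left-half point would have the smaller
        -- key. After its extra n (i + 1) steps it is above the whole translated gap; the remaining
        -- k common steps preserve the order.
        · obtain ⟨i, rfl, rfl⟩ := h.exists_eq_add_mul hk hs
          rcases lt_or_ge (t' : ℝ) 0 with h0 | h0
          · exact absurd ht (arcPosition_lt_of_neg hk t t' h0).not_gt
          · have h1 := h.le_iterate_of_q_le i (le_gapPoint_of_nonneg (u := g 1 - 1 + d) h.q_lt h0)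
            have h2 := h.strictMono_iterate k (show gapPoint (g 1 - 1 + d) q d t + ((i + 1) * l : ℤ)
              < (lift g d)^[n * (i + 1)] (gapPoint (g 1 - 1 + d) q d t') by
                push_cast
                linarith [mt.2])
            rw [iterate_lift_add_int] at h2
            rw [Function.iterate_add_apply]
            push_cast at h2 ⊢
            linarith
        · have hn : (n : ℤ) ≠ 0 := by
            have := h.n_pos
            omega
          have hm : m = m' := mul_right_cancel₀ hn (by linarith)
          have h1 := gapPoint_strictMono h.lt_q h.q_lt
            (show (t : ℝ) < t' from (arcPosition_strictMono k).lt_iff_lt.1 ht)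
          have := h.strictMono_iterate k h1
          rw [hm]
          linarith
        · obtain ⟨i, rfl, rfl⟩ := h.exists_eq_add_mul hk hs.symm
          rcases lt_or_ge (t : ℝ) 0 with h0 | h0
          · have h1 := h.iterate_lt_of_lt_q i (gapPoint_lt_of_neg (v := d) h.lt_q h0)
            have h2 := h.strictMono_iterate k' (show (lift g d)^[n * (i + 1)]
              (gapPoint (g 1 - 1 + d) q d t) <
                gapPoint (g 1 - 1 + d) q d t' + ((i + 1) * l : ℤ) by
                push_cast
                linarith [mt'.1])
            rw [iterate_lift_add_int] at h2
            rw [Function.iterate_add_apply]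
            push_cast at h2 ⊢
            linarith
          · exact absurd ht (arcPosition_lt_of_nonneg hk t' t h0).not_gt

lemma point_eq_of_key_eq (h : IsLocked g κ n l d P q) {a b : Address}
    (hab : a.key n l = b.key n l) : a.point g l d P q = b.point g l d P q := by
  obtain ⟨k, m, t⟩ := a
  obtain ⟨k', m', t'⟩ := b
  have hab := toLex.injective hab
  rw [Prod.mk.injEq] at hab
  obtain ⟨hs, ht⟩ := hab
  simp only at hs ht
  cases t with
  | bot =>
    cases t' with
    | bot => rw [h.point_bot, h.point_bot, hs]
    | coe t' => simp at ht
  | coe t =>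
    cases t' with
    | bot => simp at ht
    | coe t' =>
      rw [WithBot.map_coe, WithBot.map_coe, WithBot.coe_inj] at ht
      have key : ∀ {k k' : ℕ} {t t' : Ico (-1 : ℝ) 1}, k < k' →
          arcPosition k t ≠ arcPosition k' t' := by
        intro k k' t t' hk
        rcases lt_or_ge (t' : ℝ) 0 with h0 | h0
        · exact (arcPosition_lt_of_neg hk t t' h0).ne'
        · exact (arcPosition_lt_of_nonneg hk t t' h0).ne
      rcases lt_trichotomy k k' with hk | rfl | hk
      · exact absurd ht (key hk)
      · have hn : (n : ℤ) ≠ 0 := by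
          have := h.n_pos
          omega
        have hm : m = m' := mul_right_cancel₀ hn (by linarith)
        rw [hm, (arcPosition_strictMono k).injective ht]
      · exact absurd ht.symm (key hk)

/-- The first return to an arc around the discontinuity contracts each half of the arc. -/
lemma sub_le_or_sub_le (h : IsLocked g κ n l d P q) (N : ℕ) {y : ℝ} (hy : y ∈ Icc (P 0) (P 1)) :
    (y < 0 → (lift g d)^[n * N] y < N * l ∧ (lift g d)^[n * N] y - (P 0 + N * l) ≤ κ ^ N * (y - P 0))
    ∧ (0 ≤ y → N * l ≤ (lift g d)^[n * N] y ∧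
      P 1 + N * l - (lift g d)^[n * N] y ≤ κ ^ N * (P 1 - y)) := by
  have hg := h.profile
  have hn := h.two_le
  have hP := h.orbit
  have h1 : P 1 < 1 := by
    have e2 := hP.add_n hg h.n_pos 0
    have : P 1 < P (0 + n) := h.strictMono (by omega)
    linarith [h.neg]
  have ei : (l : ℤ) + (n - 1 : ℕ) * l = 0 + l * n := by
    rw [Nat.cast_sub (by omega)]
    push_cast
    ring
  have ei1 : (l : ℤ) + (n - 1 : ℕ) * l + 1 = 1 + l * n := by
    rw [ei]
    ring
  -- Of the n steps of a return, the last n - 1 do not expand; the factor κ comes from the first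
  -- one, taken separately on each side of the discontinuity.
  have back : ∀ {y : ℝ}, y ∈ Icc (P 0) (P 1) →
      (lift g d)^[n] y - (P 0 + l) ≤ lift g d y - P l ∧
        P 1 + l - (lift g d)^[n] y ≤ P (l + 1) - lift g d y := by
    intro y hy
    have hm := (hg.strictMono_lift d).monotone
    have m1 := hm hy.1
    have m2 := hm hy.2
    rw [h.lift_eq] at m1 m2
    rw [zero_add] at m1
    rw [add_comm] at m2
    have c := hP.iterate_lift_sub_le hg hn h.coprime h.neg h.pos ⟨m1, m2⟩ (n - 1) (by omega)
    rw [ei1, ei, ← Function.iterate_succ_apply, Nat.succ_eq_add_one, Nat.sub_add_cancel h.n_pos,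
      h.add_mul_n, h.add_mul_n] at c
    exact_mod_cast c
  have left : ∀ {y : ℝ}, y ∈ Icc (P 0) (P 1) → y < 0 →
      (lift g d)^[n] y - (P 0 + l) ≤ κ * (y - P 0) := by
    intro y hy hy0
    have f : ∀ {x : ℝ}, P 0 ≤ x → x < 0 → ⌊x⌋ = -1 := by
      intro x hx hx0
      have e2 := hP.add_n hg h.n_pos 0
      have : P 1 < P (0 + n) := h.strictMono (by omega)
      rw [Int.floor_eq_iff]
      push_cast
      constructor <;> linarith [h.pos]
    have := hg.lift_sub_le d hy.1 (by rw [f le_rfl h.neg, f hy.1 hy0])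
    rw [h.lift_eq, zero_add] at this
    exact (back hy).1.trans this
  have right : ∀ {y : ℝ}, y ∈ Icc (P 0) (P 1) → 0 ≤ y →
      P 1 + l - (lift g d)^[n] y ≤ κ * (P 1 - y) := fun hy hy0 =>
    (back hy).2.trans (hP.sub_lift_zero_le hg hn hy0 hy.2 h1)
  have mem : ∀ {y : ℝ}, y ∈ Icc (P 0) (P 1) → (lift g d)^[n] y - l ∈ Icc (P 0) (P 1) := by
    intro y hy
    have hm := (h.strictMono_iterate n).monotone
    have m1 := hm hy.1
    have m2 := hm hy.2
    rw [h.iterate_lift_eq, mul_comm, h.add_mul_n] at m1 m2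
    push_cast at m1 m2
    constructor <;> linarith
  induction N generalizing y with
  | zero => simp
  | succ N ih =>
    obtain ⟨i1, i2⟩ := ih (mem hy)
    have h3 := iterate_lift_add_int g d ((lift g d)^[n] y - l) l (n * N)
    push_cast at h3
    rw [sub_add_cancel, ← Function.iterate_add_apply, ← Nat.mul_succ, Nat.succ_eq_add_one] at h3
    rw [h3]
    have hκ : 0 ≤ κ ^ N := pow_nonneg hg.pos.le N
    push_cast
    constructor
    · intro hy0
      have := left hy hy0
      have k1 : κ * (y - P 0) ≤ y - P 0 :=
        mul_le_of_le_one_left (sub_nonneg.2 hy.1) hg.lt_one.le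
      obtain ⟨j1, j2⟩ := i1 (by linarith)
      have := mul_le_mul_of_nonneg_left this hκ
      refine ⟨by linarith, ?_⟩
      rw [pow_succ, mul_assoc]
      linarith
    · intro hy0
      have := right hy hy0
      have k1 : κ * (P 1 - y) ≤ P 1 - y :=
        mul_le_of_le_one_left (sub_nonneg.2 hy.2) hg.lt_one.le
      obtain ⟨j1, j2⟩ := i2 (by linarith)
      have := mul_le_mul_of_nonneg_left this hκ
      refine ⟨by linarith, ?_⟩
      rw [pow_succ, mul_assoc]
      linarith

lemma exists_mem_arc (h : IsLocked g κ n l d P q) (x : ℝ) : ∃ s, x ∈ Ico (P s) (P (s + 1)) := by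
  have hn : (n : ℤ) ≠ 0 := by
    have := h.n_pos
    omega
  have e0 := h.add_mul_n 0 ⌊x⌋
  have e1 := h.add_mul_n 1 (⌊x⌋ + 1)
  have f0 := Int.floor_le x
  have f1 := Int.lt_floor_add_one x
  rw [zero_add] at e0
  push_cast at e1
  obtain ⟨s, hs, hmax⟩ := Int.exists_greatest_of_bdd (P := fun s => P s ≤ x)
    ⟨1 + (⌊x⌋ + 1) * n, fun z hz => by
      refine h.strictMono.le_iff_le.1 (hz.trans ?_)
      linarith [h.pos]⟩
    ⟨⌊x⌋ * n, by linarith [h.neg]⟩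
  refine ⟨s, hs, lt_of_not_ge fun hle => ?_⟩
  have := hmax _ hle
  omega

lemma exists_point_eq_orbit (h : IsLocked g κ n l d P q) (s : ℤ) :
    ∃ a : Address, a.point g l d P q = P s := by
  obtain ⟨k, m, -, hkm⟩ := exists_nat_mul_add_mul h.n_pos h.coprime (s - l)
  exact ⟨(k, m, ⊥), by rw [h.point_bot, ← hkm, add_sub_cancel]⟩

/-- Suppose such a point lay strictly inside an arc. Pulled back to the arc around the
discontinuity, it would be an N-th return of a point of that arc for every N, hence within κ ^ N of
an end, which fails for large N. -/
lemma exists_orbit_eq (h : IsLocked g κ n l d P q) {x : ℝ}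
    (hx : ∀ k : ℕ, ∃ y, (lift g d)^[k] y = x) : ∃ s, P s = x := by
  obtain ⟨s, hs⟩ := h.exists_mem_arc x
  refine ⟨s, hs.1.antisymm (le_of_not_gt fun hlt => ?_)⟩
  obtain ⟨j, m, -, rfl⟩ := exists_nat_mul_add_mul h.n_pos h.coprime s
  have e0 : P (j * l + m * n) = (lift g d)^[j] (P 0) + m := by
    rw [h.add_mul_n, h.iterate_lift_eq, zero_add]
  have e1 : P (j * l + m * n + 1) = (lift g d)^[j] (P 1) + m := by
    rw [h.iterate_lift_eq, ← h.add_mul_n]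
    congr 1
    ring
  rw [e0] at hlt
  have hlt' := hs.2
  rw [e1] at hlt'
  obtain ⟨z, hz⟩ : ∃ z, (lift g d)^[j] z = x - m := by
    obtain ⟨y, hy⟩ := hx j
    refine ⟨y - m, ?_⟩
    have := iterate_lift_add_int g d (y - m) m j
    rw [sub_add_cancel, hy] at this
    linarith
  have z0 : P 0 < z := (h.strictMono_iterate j).lt_iff_lt.1 (by linarith)
  have z1 : z < P 1 := (h.strictMono_iterate j).lt_iff_lt.1 (by linarith)
  obtain ⟨N, hN⟩ := exists_pow_lt_of_lt_one
    (show 0 < min (z - P 0) (P 1 - z) from lt_min (by linarith) (by linarith)) h.profile.lt_one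
  obtain ⟨hN0, hN1⟩ := lt_min_iff.1 hN
  -- Preimages of x of order j + n N give preimages of z of order n N up to integer translation,
  -- because iterates are injective.
  obtain ⟨y, hy⟩ : ∃ y, (lift g d)^[n * N] y = z + (N * l : ℤ) := by
    obtain ⟨y, hy⟩ := hx (j + n * N)
    refine ⟨y - m + (N * l : ℤ), (h.strictMono_iterate j).injective ?_⟩
    have := iterate_lift_add_int g d (y - m) m (j + n * N)
    rw [sub_add_cancel, hy] at this
    rw [iterate_lift_add_int, iterate_lift_add_int, iterate_lift_add_int,
      ← Function.iterate_add_apply, hz]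
    linarith
  push_cast at hy
  have f : ∀ s, (lift g d)^[n * N] (P s) = P s + N * l := by
    intro s
    rw [h.iterate_lift_eq, show s + ((n * N : ℕ) : ℤ) * l = s + (N * l) * n by push_cast; ring,
      h.add_mul_n]
    push_cast
    ring
  have y0 : P 0 < y := (h.strictMono_iterate (n * N)).lt_iff_lt.1 (by rw [f, hy]; linarith)
  have y1 : y < P 1 := (h.strictMono_iterate (n * N)).lt_iff_lt.1 (by rw [f, hy]; linarith)
  have c := h.sub_le_or_sub_le N ⟨y0.le, y1.le⟩
  rw [hy] at c
  have hκ : 0 ≤ κ ^ N := pow_nonneg h.profile.pos.le N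
  have hlen : P 1 - P 0 ≤ 1 := by
    have e2 := h.orbit.add_n h.profile h.n_pos 0
    have : P 1 < P (0 + n) := h.strictMono (by have := h.two_le; omega)
    linarith
  rcases lt_or_ge y 0 with hy0 | hy0
  · have := (c.1 hy0).2
    have : κ ^ N * (y - P 0) ≤ κ ^ N := mul_le_of_le_one_right hκ (by linarith)
    linarith
  · have := (c.2 hy0).2
    have : κ ^ N * (P 1 - y) ≤ κ ^ N := mul_le_of_le_one_right hκ (by linarith)
    linarith

/-- A point with preimages of all orders lies on `P`. Otherwise its last available preimage is
outside the image of the lift, hence in a translate of the gap. -/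
lemma point_surjective (h : IsLocked g κ n l d P q) :
    Function.Surjective (Address.point g l d P q) := by
  intro x
  by_cases hx : ∀ k : ℕ, ∃ y, (lift g d)^[k] y = x
  · obtain ⟨s, rfl⟩ := h.exists_orbit_eq hx
    exact h.exists_point_eq_orbit s
  · have hex : ∃ k : ℕ, ¬ ∃ y, (lift g d)^[k] y = x := not_forall.1 hx
    classical
    have h0 : Nat.find hex ≠ 0 := fun h0 => Nat.find_spec hex (by rw [h0]; exact ⟨x, rfl⟩)
    obtain ⟨k, hk⟩ := Nat.exists_eq_succ_of_ne_zero h0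
    obtain ⟨y, hy⟩ := not_not.1 (Nat.find_min hex (m := k) (by omega))
    have hnot := Nat.find_spec hex
    rw [hk] at hnot
    rcases h.profile.exists_lift_eq_or_mem_gap d y with ⟨z, hz⟩ | ⟨m, hm⟩
    · exact absurd ⟨z, by rw [Function.iterate_succ_apply, hz, hy]⟩ hnot
    · obtain ⟨t, ht, hty⟩ := exists_gapPoint_eq h.lt_q h.q_lt hm
      refine ⟨(k, m, ((⟨t, ht⟩ : Ico (-1 : ℝ) 1) : WithBot _)), ?_⟩
      simp only [Address.point, basePoint]
      rw [hty, ← iterate_lift_add_int, sub_add_cancel, hy]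

end IsLocked

/-! ### The conjugacy -/

/-- Two surjections onto the line that induce the same order differ by an order isomorphism. -/
lemma exists_orderIso_of_key {A K : Type*} [LinearOrder K] (key : A → K) {u v : A → ℝ}
    (hu : Function.Surjective u) (hv : Function.Surjective v)
    (hul : ∀ a b, key a < key b → u a < u b) (hue : ∀ a b, key a = key b → u a = u b)
    (hvl : ∀ a b, key a < key b → v a < v b) (hve : ∀ a b, key a = key b → v a = v b) :
    ∃ φ : ℝ ≃o ℝ, ∀ a, φ (u a) = v a := by
  have iff_u : ∀ a b, u a < u b ↔ key a < key b := by
    refine fun a b => ⟨fun h => ?_, hul a b⟩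
    rcases lt_trichotomy (key a) (key b) with h' | h' | h'
    · exact h'
    · exact absurd (hue _ _ h') h.ne
    · exact absurd (hul _ _ h') h.not_gt
  have uv : ∀ a b, u a < u b → v a < v b := fun a b h => hvl a b ((iff_u a b).1 h)
  have uv' : ∀ a b, u a = u b → v a = v b := fun a b h => hve a b <| by
    refine le_antisymm (le_of_not_gt fun h' => ?_) (le_of_not_gt fun h' => ?_)
    · exact (hul _ _ h').ne' h
    · exact (hul _ _ h').ne h
  choose w hw using hu
  have hφ : ∀ a, v (w (u a)) = v a := fun a => uv' _ _ (hw _)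
  have hmono : StrictMono fun x => v (w x) := fun x y hxy => uv _ _ (by rwa [hw, hw])
  exact ⟨hmono.orderIsoOfSurjective _ fun y => by
    obtain ⟨a, rfl⟩ := hv y
    exact ⟨u a, hφ a⟩, hφ⟩

/-- Mode-locked lifts with the same rotation number are conjugate, by a conjugacy that fixes the
discontinuities. -/
lemma IsLocked.exists_conj {g g' : ℝ → ℝ} {κ κ' : ℝ} {n l : ℕ} {d d' : ℝ} {P P' : ℤ → ℝ}
    {q q' : ℝ} (h : IsLocked g κ n l d P q) (h' : IsLocked g' κ' n l d' P' q') :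
    ∃ φ : ℝ ≃o ℝ, (∀ x, φ (lift g d x) = lift g' d' (φ x)) ∧ (∀ (x : ℝ) (m : ℤ), φ (x + m) = φ x + m)
      ∧ φ 0 = 0 := by
  obtain ⟨φ, hφ⟩ := exists_orderIso_of_key (Address.key n l) h.point_surjective h'.point_surjective
    (fun _ _ => h.point_lt_of_key_lt) (fun _ _ => h.point_eq_of_key_eq)
    (fun _ _ => h'.point_lt_of_key_lt) (fun _ _ => h'.point_eq_of_key_eq)
  refine ⟨φ, fun x => ?_, fun x m => ?_, ?_⟩
  · obtain ⟨⟨k, m, t⟩, rfl⟩ := h.point_surjective x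
    have e := hφ (k + 1, m, t)
    simp only [Address.point, Function.iterate_succ_apply'] at e
    rw [hφ]
    simp only [Address.point, lift_add_int]
    exact e
  · obtain ⟨⟨k, i, t⟩, rfl⟩ := h.point_surjective x
    have e := hφ (k, i + m, t)
    rw [hφ]
    simp only [Address.point] at e ⊢
    push_cast at e
    rw [← add_assoc, ← add_assoc] at e
    exact e
  -- This address names 0 in both systems: parameter 0 is q, which reaches l after n - 1 steps.
  · have e := hφ (n - 1, -l, ((⟨0, by norm_num⟩ : Ico (-1 : ℝ) 1) : WithBot _))
    have z : ∀ u q v : ℝ, gapPoint u q v 0 = q := fun u q v => by simp [gapPoint]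
    simp only [Address.point, basePoint, z, h.iterate_q, h'.iterate_q] at e
    simpa using e

lemma fract_orderIso {φ : ℝ ≃o ℝ} (hφ : ∀ (x : ℝ) (m : ℤ), φ (x + m) = φ x + m) (h0 : φ 0 = 0)
    (y : ℝ) : φ (Int.fract y) = Int.fract (φ y) := by
  have h1 : φ 1 = 1 := by simpa [h0] using hφ 0 1
  have a : 0 ≤ φ (Int.fract y) := h0 ▸ φ.monotone (Int.fract_nonneg y)
  have b : φ (Int.fract y) < 1 := h1 ▸ φ.strictMono (Int.fract_lt_one y)
  have e := hφ (Int.fract y) ⌊y⌋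
  rw [Int.fract_add_floor] at e
  rw [e, Int.fract_add_intCast, Int.fract_eq_self.2 ⟨a, b⟩]

lemma topConjugate_of_isLocked {g g' : ℝ → ℝ} {κ κ' : ℝ} {n l : ℕ} {d d' : ℝ} {P P' : ℤ → ℝ}
    {q q' : ℝ} (h : IsLocked g κ n l d P q) (h' : IsLocked g' κ' n l d' P' q') {F G : ℝ → ℝ}
    (hF : ∀ x ∈ Ico (0 : ℝ) 1, F x = Int.fract (lift g d x))
    (hG : ∀ x ∈ Ico (0 : ℝ) 1, G x = Int.fract (lift g' d' x)) : TopConjugate F G := by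
  obtain ⟨φ, hconj, hadd, h0⟩ := h.exists_conj h'
  have h1 : φ 1 = 1 := by simpa [h0] using hadd 0 1
  have hmem : ∀ x, x ∈ Ico (0 : ℝ) 1 ↔ φ.toHomeomorph x ∈ Ico (0 : ℝ) 1 := by
    intro x
    have a := φ.le_iff_le (x := 0) (y := x)
    have b := φ.lt_iff_lt (x := x) (y := 1)
    rw [h0] at a
    rw [h1] at b
    exact and_congr a.symm b.symm
  refine ⟨fun x hx => ?_, fun x hx => ?_, φ.toHomeomorph.subtype hmem, fun x => Subtype.ext ?_⟩
  · rw [hF x hx]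
    exact ⟨Int.fract_nonneg _, Int.fract_lt_one _⟩
  · rw [hG x hx]
    exact ⟨Int.fract_nonneg _, Int.fract_lt_one _⟩
  · change φ (F x) = G (φ x)
    rw [hF x x.2, hG (φ x) ((hmem x).1 x.2), fract_orderIso hadd h0, hconj]

/-! ### Locking intervals and their order -/

namespace IsOrbit

variable {g : ℝ → ℝ} {κ : ℝ} {n l : ℕ} {d : ℝ} {P : ℤ → ℝ}

/-- A larger rotation number needs a larger translation. -/
lemma lt_of_rotation_lt (hg : IsContractiveProfile g κ) {n' l' : ℕ} {d' : ℝ} {Q : ℤ → ℝ}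
    (hn : 0 < n) (hnl : Nat.Coprime n l) (hP : IsOrbit g n l d P) (hP1 : P 1 = 0)
    (hn' : 0 < n') (hnl' : Nat.Coprime n' l') (hQ : IsOrbit g n' l' d' Q) (hQ0 : Q 0 = 0)
    (hrot : n * l' < n' * l) : d' < d := by
  by_contra! hd
  -- Start at P (1 - n) = -1 < 0 = Q 0. Since P 1 = 0 and Q 0 = 0, the prescribed cells are
  -- compatible with the order, so if d ≤ d' the orbit of `P` stays below that of `Q`.
  have key : ∀ k : ℕ, P (1 - n + k * l) < Q (k * l') := by
    intro k
    induction k with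
    | zero =>
      have e := hP.add_n hg hn (1 - n)
      rw [sub_add_cancel] at e
      simp only [Nat.cast_zero, zero_mul, add_zero]
      linarith
    | succ k ih =>
      have a := (hP.sub_cell_mem hg hn hnl (1 - n + k * l)).1
      have b := (hQ.sub_cell_mem hg hn' hnl' (k * l')).2
      have c : cell n (1 - n + k * l) < cell n' (k * l') + 1 := by
        have : (cell n (1 - n + k * l) : ℝ) < cell n' (k * l') + 1 := by linarith
        exact_mod_cast this
      have c' : (cell n (1 - n + k * l) : ℝ) ≤ cell n' (k * l') := by
        exact_mod_cast Int.lt_add_one_iff.1 c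
      have h1 := hg.branch_le (P (1 - n + k * l)) c'
      have h2 := hg.strictMono (sub_lt_sub_right ih (cell n' (k * l') : ℝ))
      rw [show 1 - (n : ℤ) + (k + 1 : ℕ) * l = 1 - n + k * l + l by push_cast; ring,
        show ((k + 1 : ℕ) : ℤ) * l' = k * l' + l' by push_cast; ring, hP.step, hQ.step]
      linarith
  -- After n n' steps the two points are n' l - 1 and n l', which contradicts the order of the
  -- rotation numbers.
  have h := key (n * n')
  have e1 := hP.add_mul_n hg hn 1 (n' * l - 1)
  have e2 := hQ.add_mul_n hg hn' 0 (n * l')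
  rw [show 1 - (n : ℤ) + (n * n' : ℕ) * l = 1 + (n' * l - 1) * n by push_cast; ring, e1, hP1,
    show ((n * n' : ℕ) : ℤ) * l' = 0 + (n * l') * n' by push_cast; ring, e2, hQ0] at h
  have : (n : ℝ) * l' + 1 ≤ n' * l := by exact_mod_cast hrot
  push_cast at h
  linarith

/-- When the orbit meets the discontinuity, the discontinuity is the image of another point of the
orbit. -/
lemma discontinuity (hg : IsContractiveProfile g κ) (hn : 0 < n) (hnl : Nat.Coprime n l)
    (hl : 0 < l) (hln : l < n) (hP : IsOrbit g n l d P) {i : ℤ} (hi : i = 0 ∨ i = 1)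
    (hPi : P i = 0) : P (i - l + n) ∈ Ioo (0 : ℝ) 1 ∧ g (P (i - l + n)) = 1 - d := by
  have hmono := hP.strictMono hg hn hnl
  have e := hP.step (i - l)
  rw [sub_add_cancel, cell_eq_neg_one (i - l) (by omega) (by omega), hPi] at e
  have e1 := hP.add_n hg hn (i - l)
  have e2 := hP.add_n hg hn i
  have a : P i < P (i - l + n) := hmono (by omega)
  have b : P (i - l + n) < P (i + n) := hmono (by omega)
  refine ⟨⟨by linarith, by linarith⟩, ?_⟩
  push_cast at e
  rw [sub_neg_eq_add] at e
  rw [e1]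
  linarith

lemma translation_lt (hg : IsContractiveProfile g κ) (hn : 0 < n) (hnl : Nat.Coprime n l)
    {dL dR : ℝ} {PL PR : ℤ → ℝ} (hL : IsOrbit g n l dL PL) (hL1 : PL 1 = 0)
    (hR : IsOrbit g n l dR PR) (hR0 : PR 0 = 0) : dL < dR := by
  by_contra! h
  have := hR.add_sub_le hg hL h 1
  have : PR 0 < PR 1 := hR.strictMono hg hn hnl (by omega)
  linarith

/-- Between the two end translations, strict growth in d pushes P 0 below 0 and P 1 above 0. -/
lemma exists_isLocked_of_lt (hg : IsContractiveProfile g κ) (hn : 2 ≤ n) (hnl : Nat.Coprime n l)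
    {dL dR : ℝ} {PL PR : ℤ → ℝ} (hL : IsOrbit g n l dL PL) (hL1 : PL 1 = 0)
    (hR : IsOrbit g n l dR PR) (hR0 : PR 0 = 0) (h1 : dL < d) (h2 : d < dR) :
    ∃ P q, IsLocked g κ n l d P q := by
  obtain ⟨P, hP⟩ := exists_isOrbit hg (show 0 < n by omega) l d
  have a := hP.add_sub_le hg hR h2.le 0
  have b := hL.add_sub_le hg hP h1.le 1
  obtain ⟨q, hq⟩ := hP.exists_isLocked hg hn hnl (by linarith) (by linarith)
  exact ⟨P, q, hq⟩

end IsOrbit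

/-! ### The linear family: explicit end points -/

section Linear

variable {α β : ℝ} {n l : ℕ} {P : ℤ → ℝ}

lemma isContractiveProfile_linear (h0 : 0 < α) (h1 : α < 1) :
    IsContractiveProfile (fun x => α * x) α where
  pos := h0
  lt_one := h1
  strictMono := fun x y h => mul_lt_mul_of_pos_left h h0
  sub_le := fun x y _ => by rw [mul_sub]
  zero := mul_zero _
  one_lt := by simpa using h1

lemma IsOrbit.linear_eq_sum (hP : IsOrbit (fun x => α * x) n l β P) (s : ℤ) (k : ℕ) :
    P s = ∑ i ∈ Finset.range k, α ^ i * ((1 - α) * cell n (s - (i + 1) * l) + β) +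
      α ^ k * P (s - k * l) := by
  induction k with
  | zero => simp
  | succ k ih =>
    have e := hP.step (s - (k + 1) * l)
    rw [show s - ((k : ℤ) + 1) * l + l = s - k * l by ring] at e
    rw [ih, Finset.sum_range_succ, e]
    push_cast
    ring

/-- Unrolling the recursion n steps back returns to the same point lowered by l, which gives a
linear equation for P s. -/
lemma IsOrbit.linear_eq (h0 : 0 < α) (h1 : α < 1) (hn : 0 < n)
    (hP : IsOrbit (fun x => α * x) n l β P) (s : ℤ) :
    (1 - α ^ n) * P s = (1 - α) * ∑ i ∈ Finset.range n, α ^ i * cell n (s - (i + 1) * l) +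
      β * ∑ i ∈ Finset.range n, α ^ i - α ^ n * l := by
  have h := hP.linear_eq_sum s n
  have e := hP.add_mul_n (isContractiveProfile_linear h0 h1) hn s (-l)
  rw [show s + -(l : ℤ) * n = s - n * l by ring] at e
  push_cast at e
  rw [e] at h
  have hs : ∑ i ∈ Finset.range n, α ^ i * ((1 - α) * cell n (s - (i + 1) * l) + β) =
      (1 - α) * ∑ i ∈ Finset.range n, α ^ i * cell n (s - (i + 1) * l) +
        β * ∑ i ∈ Finset.range n, α ^ i := by
    rw [Finset.mul_sum, Finset.mul_sum, ← Finset.sum_add_distrib]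
    exact Finset.sum_congr rfl fun i _ => by ring
  rw [hs] at h
  linarith

lemma charSeq_eq (n l i : ℕ) :
    charSeq n l i = (((i + 1 : ℕ) : ℤ) * l) / n - ((i : ℤ) * l) / n := by
  have e : ∀ j : ℕ, ⌊((j : ℝ) * l) / n⌋ = ((j : ℤ) * l) / n := by
    intro j
    have := Int.floor_div_cast_of_nonneg (Int.natCast_nonneg n) ((j : ℝ) * l)
    rw [Int.cast_natCast] at this
    rw [this]
    congr 1
    exact_mod_cast Int.floor_natCast (R := ℝ) (j * l)
  rw [charSeq, ← e, ← e]
  push_cast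
  rfl

lemma cell_neg (hn : 0 < n) (a : ℤ) : cell n (-a) = -(a / n) - 1 := by
  unfold cell
  have h1 := Int.emod_add_mul_ediv a n
  have h2 := Int.emod_nonneg a (show (n : ℤ) ≠ 0 by omega)
  have h3 := Int.emod_lt_of_pos a (show (0 : ℤ) < n by omega)
  rw [Int.ediv_eq_iff_of_pos (by omega)]
  constructor <;> nlinarith

/-- Summation by parts for the characteristic sequence. -/
lemma sum_mul_floor (hn : 0 < n) (hl : l < n) (α : ℝ) :
    (1 - α) * ∑ i ∈ Finset.range n, α ^ i * (((((i + 1 : ℕ) : ℤ) * l) / n : ℤ) : ℝ) =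
      ∑ m ∈ Finset.Icc 1 (n - 1), (charSeq n l m : ℝ) * α ^ m - α ^ n * l := by
  have h : ∀ k : ℕ, (1 - α) * ∑ i ∈ Finset.range k, α ^ i * (((((i + 1 : ℕ) : ℤ) * l) / n : ℤ) : ℝ)
      = ∑ i ∈ Finset.range k, (charSeq n l i : ℝ) * α ^ i
        - α ^ k * ((((k : ℤ) * l) / n : ℤ) : ℝ) := by
    intro k
    induction k with
    | zero => simp
    | succ k ih =>
      rw [Finset.sum_range_succ, Finset.sum_range_succ, mul_add, ih, charSeq_eq]
      push_cast
      ring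
  have h0 : charSeq n l 0 = 0 := by
    have := charSeq_eq n l 0
    simp only [Nat.cast_zero] at this
    rw [this]
    have := Int.ediv_eq_zero_of_lt (show (0 : ℤ) ≤ l by omega) (show (l : ℤ) < n by omega)
    simp [this]
  rw [h n, Int.mul_ediv_cancel_left _ (by omega), Finset.range_eq_Ico,
    Finset.sum_eq_sum_Ico_succ_bot hn]
  have : Finset.Ico (0 + 1) n = Finset.Icc 1 (n - 1) := by
    ext x
    simp only [Finset.mem_Ico, Finset.mem_Icc]
    omega
  rw [this]
  simp [h0]

lemma IsOrbit.linear_zero (h0 : 0 < α) (h1 : α < 1) (hn : 0 < n) (hl : l < n)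
    (hP : IsOrbit (fun x => α * x) n l β P) : (1 - α) * P 0 = β - upperB n l α := by
  have h := hP.linear_eq h0 h1 hn 0
  have hs := sum_mul_floor hn hl α
  have hpow : 0 < 1 - α ^ n := by linarith [pow_lt_one₀ h0.le h1 hn.ne']
  have hα : 0 < 1 - α := by linarith
  have e : ∑ i ∈ Finset.range n, α ^ i * (cell n (0 - (i + 1) * l) : ℝ) =
      -(∑ i ∈ Finset.range n, α ^ i * (((((i + 1 : ℕ) : ℤ) * l) / n : ℤ) : ℝ))
        - ∑ i ∈ Finset.range n, α ^ i := by
    rw [← Finset.sum_neg_distrib, ← Finset.sum_sub_distrib]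
    refine Finset.sum_congr rfl fun i _ => ?_
    rw [zero_sub, cell_neg hn]
    push_cast
    ring
  have hgeom := mul_neg_geom_sum α n
  rw [e] at h
  unfold upperB
  generalize ∑ i ∈ Finset.range n, α ^ i * (((((i + 1 : ℕ) : ℤ) * l) / n : ℤ) : ℝ) = V at *
  generalize ∑ m ∈ Finset.Icc 1 (n - 1), (charSeq n l m : ℝ) * α ^ m = K at *
  generalize ∑ i ∈ Finset.range n, α ^ i = S at *
  apply mul_left_cancel₀ hpow.ne'
  field_simp
  linear_combination (1 - α) * h + (β - (1 - α)) * hgeom - (1 - α) * hs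

/-- The sums for P 1 and P 0 differ only in their last term, the one whose index is divisible by n.
This contributes α ^ (n - 1), the source of the difference between the two boundary functions. -/
lemma IsOrbit.linear_one (h0 : 0 < α) (h1 : α < 1) (hn : 0 < n) (hl : l < n)
    (hnl : Nat.Coprime n l) (hP : IsOrbit (fun x => α * x) n l β P) :
    (1 - α) * P 1 = β - lowerB n l α := by
  have hz := hP.linear_zero h0 h1 hn hl
  have h := hP.linear_eq h0 h1 hn 0
  have h' := hP.linear_eq h0 h1 hn 1
  have hpow : 0 < 1 - α ^ n := by linarith [pow_lt_one₀ h0.le h1 hn.ne']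
  have hα : 0 < 1 - α := by linarith
  obtain ⟨k, rfl⟩ := Nat.exists_eq_succ_of_ne_zero hn.ne'
  have e : ∑ i ∈ Finset.range (k + 1), α ^ i * (cell (k + 1) (1 - (i + 1) * l) : ℝ) =
      ∑ i ∈ Finset.range (k + 1), α ^ i * (cell (k + 1) (0 - (i + 1) * l) : ℝ) + α ^ k := by
    rw [Finset.sum_range_succ, Finset.sum_range_succ, add_assoc]
    congr 1
    · refine Finset.sum_congr rfl fun i hi => ?_
      have hi := Finset.mem_range.1 hi
      have := not_dvd_mul_of_coprime hnl (i := i + 1) (by omega) (by omega)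
      rw [← cell_succ_of_not_dvd hn (s := 0 - (i + 1) * l)]
      · rw [show 0 - ((i : ℤ) + 1) * l + 1 = 1 - (i + 1) * l by ring]
      · rw [zero_sub, dvd_neg]
        exact_mod_cast this
    · have e1 : cell (k + 1) (1 - ((k : ℤ) + 1) * l) = -l := by
        have := Int.mul_ediv_cancel_left (-(l : ℤ)) (show ((k + 1 : ℕ) : ℤ) ≠ 0 by omega)
        unfold cell
        rw [← this]
        congr 1
        push_cast
        ring
      have e2 : cell (k + 1) (0 - ((k : ℤ) + 1) * l) = -l - 1 := by
        have := Int.mul_ediv_cancel_left (l : ℤ) (show ((k + 1 : ℕ) : ℤ) ≠ 0 by omega)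
        rw [zero_sub, cell_neg hn]
        push_cast at this ⊢
        rw [this]
      rw [e1, e2]
      push_cast
      ring
  rw [Nat.succ_eq_add_one] at *
  rw [e] at h'
  have hd : lowerB (k + 1) l α = upperB (k + 1) l α -
      (1 - α) * ((α ^ k - α ^ (k + 1)) / (1 - α ^ (k + 1))) := by
    rw [lowerB, upperB, Nat.add_sub_cancel]
    ring
  rw [hd]
  have : (1 - α ^ (k + 1)) * (P 1 - P 0) = (1 - α) * α ^ k := by linarith
  have : P 1 - P 0 = (1 - α) * α ^ k / (1 - α ^ (k + 1)) := by
    rw [eq_div_iff hpow.ne']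
    linarith
  have : (α ^ k - α ^ (k + 1)) / (1 - α ^ (k + 1)) = P 1 - P 0 := by
    rw [this]
    ring
  rw [this]
  linarith

lemma exists_isLocked_linear (h0 : 0 < α) (h1 : α < 1) (hn : 2 ≤ n) (hl : l < n)
    (hnl : Nat.Coprime n l) (hL : lowerB n l α < β) (hU : β < upperB n l α) :
    ∃ P q, IsLocked (fun x => α * x) α n l β P q := by
  have hg := isContractiveProfile_linear h0 h1
  have hn0 : 0 < n := by omega
  obtain ⟨P, hP⟩ := exists_isOrbit hg hn0 l β
  have e0 := hP.linear_zero h0 h1 hn0 hl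
  have e1 := hP.linear_one h0 h1 hn0 hl hnl
  obtain ⟨q, hq⟩ := hP.exists_isLocked hg hn hnl
    (by by_contra! h; nlinarith) (by by_contra! h; nlinarith)
  exact ⟨P, q, hq⟩

/-- At either boundary value the orbit meets the discontinuity, so α x = 1 - β for some x in (0,1),
which places β in (1 - α, 1). -/
lemma bounds_mem (h0 : 0 < α) (h1 : α < 1) (hn : 2 ≤ n) (hl0 : 0 < l) (hl : l < n)
    (hnl : Nat.Coprime n l) : 0 < lowerB n l α ∧ lowerB n l α < upperB n l α ∧
      upperB n l α < 1 := by
  have hg := isContractiveProfile_linear h0 h1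
  have hn0 : 0 < n := by omega
  obtain ⟨P, hP⟩ := exists_isOrbit hg hn0 l (lowerB n l α)
  obtain ⟨Q, hQ⟩ := exists_isOrbit hg hn0 l (upperB n l α)
  have e0 := hQ.linear_zero h0 h1 hn0 hl
  have e1 := hP.linear_one h0 h1 hn0 hl hnl
  have hα : 1 - α ≠ 0 := by linarith
  rw [sub_self] at e0 e1
  have e0 := (mul_eq_zero.1 e0).resolve_left hα
  have e1 := (mul_eq_zero.1 e1).resolve_left hα
  obtain ⟨a1, a2⟩ := hP.discontinuity hg hn0 hnl hl0 hl (Or.inr rfl) e1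
  obtain ⟨b1, b2⟩ := hQ.discontinuity hg hn0 hnl hl0 hl (Or.inl rfl) e0
  refine ⟨?_, IsOrbit.translation_lt hg hn0 hnl hP e1 hQ e0, ?_⟩
  · nlinarith [a1.1, a1.2]
  · nlinarith [b1.1, b1.2]

lemma continuousAt_upperB (h0 : 0 < α) (h1 : α < 1) (hn : 0 < n) :
    ContinuousAt (upperB n l) α := by
  have hpow : 1 - α ^ n ≠ 0 := by linarith [pow_lt_one₀ h0.le h1 hn.ne']
  unfold upperB
  fun_prop (disch := assumption)

lemma continuousAt_lowerB (h0 : 0 < α) (h1 : α < 1) (hn : 0 < n) :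
    ContinuousAt (lowerB n l) α := by
  have hpow : 1 - α ^ n ≠ 0 := by linarith [pow_lt_one₀ h0.le h1 hn.ne']
  unfold lowerB
  fun_prop (disch := assumption)

lemma interior_regionD_nonempty (hn : 2 ≤ n) (hl0 : 0 < l) (hl : l < n) (hnl : Nat.Coprime n l) :
    (interior (regionD n l)).Nonempty := by
  have hn0 : 0 < n := by omega
  obtain ⟨a, b, c⟩ := bounds_mem (α := 1 / 2) (by norm_num) (by norm_num) hn hl0 hl hnl
  obtain ⟨β, hL, hU⟩ := exists_between b
  refine ⟨(1 / 2, β), mem_interior_iff_mem_nhds.2 ?_⟩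
  have cf : ContinuousAt (Prod.fst : ℝ × ℝ → ℝ) (1 / 2, β) := continuousAt_fst
  have cs : ContinuousAt (Prod.snd : ℝ × ℝ → ℝ) (1 / 2, β) := continuousAt_snd
  have cL : ContinuousAt (fun p : ℝ × ℝ => lowerB n l p.1) (1 / 2, β) :=
    (continuousAt_lowerB (by norm_num) (by norm_num) hn0).comp' cf
  have cU : ContinuousAt (fun p : ℝ × ℝ => upperB n l p.1) (1 / 2, β) :=
    (continuousAt_upperB (by norm_num) (by norm_num) hn0).comp' cf
  filter_upwards [cf.eventually_mem (Ioo_mem_nhds (a := (0 : ℝ)) (b := 1) (by norm_num) (by norm_num)),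
    cs.eventually_mem (Ioo_mem_nhds (a := (0 : ℝ)) (b := 1) (by simp only; linarith)
      (by simp only; linarith)),
    cL.eventually_lt cs hL, cs.eventually_lt cU hU] with p h1 h2 h3 h4
  exact ⟨h1, h2, h3.le, h4⟩

/-- An interior point can be moved slightly down in β within the region. -/
lemma lowerB_lt_of_mem_interior {p : ℝ × ℝ} (hp : p ∈ interior (regionD n l)) :
    lowerB n l p.1 < p.2 := by
  have hc : Continuous fun t : ℝ => (p.1, p.2 - t) := by fun_prop
  have h1 : ∀ᶠ t in nhds (0 : ℝ), (p.1, p.2 - t) ∈ interior (regionD n l) :=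
    hc.continuousAt.eventually_mem (isOpen_interior.mem_nhds (by simpa using hp))
  obtain ⟨ε, hε, h2⟩ := Metric.eventually_nhds_iff.1 h1
  have h3 := h2 (y := ε / 2) (by rw [Real.dist_eq, sub_zero, abs_of_pos] <;> linarith)
  have := (interior_subset h3).2.2.1
  simp only at this
  linarith

end Linear

/-! ### Extension of f and the main theorem -/

/-- Extension of a contraction of `[0,1]` to the line. -/
lemma exists_isContractiveProfile {f : ℝ → ℝ} (hmono : StrictMonoOn f (Icc (0 : ℝ) 1))
    (h0 : f 0 = 0) (h1 : f 1 < 1) {κ : ℝ} (hκ : κ < 1)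
    (hcontr : ∀ x ∈ Icc (0 : ℝ) 1, ∀ y ∈ Icc (0 : ℝ) 1, |f x - f y| ≤ κ * |x - y|) :
    ∃ g, IsContractiveProfile g κ ∧ EqOn g f (Icc 0 1) := by
  have m0 : (0 : ℝ) ∈ Icc (0 : ℝ) 1 := ⟨le_rfl, zero_le_one⟩
  have m1 : (1 : ℝ) ∈ Icc (0 : ℝ) 1 := ⟨zero_le_one, le_rfl⟩
  have hκ0 : 0 < κ := by
    have a := hcontr 1 m1 0 m0
    have b := hmono m0 m1 zero_lt_one
    rw [abs_of_pos (by linarith), sub_zero, abs_one, mul_one] at a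
    linarith
  -- Clamping to [0,1]; the extension continues f with slope κ outside, which keeps it strictly
  -- increasing and κ-contracting.
  let r : ℝ → ℝ := fun x => max 0 (min 1 x)
  have hr : ∀ x, r x ∈ Icc (0 : ℝ) 1 := fun x =>
    ⟨le_max_left _ _, max_le zero_le_one (min_le_left _ _)⟩
  have hrm : Monotone r := fun x y h => max_le_max le_rfl (min_le_min le_rfl h)
  have hrs : ∀ x y, x ≤ y → r y - r x ≤ y - x := by
    intro x y h
    simp only [r]
    rcases max_cases 0 (min 1 y) with a | a <;> rcases min_cases 1 y with b | b <;>
      rcases max_cases 0 (min 1 x) with c | c <;> rcases min_cases 1 x with e | e <;> linarith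
  have hri : ∀ x ∈ Icc (0 : ℝ) 1, r x = x := fun x hx => by
    simp only [r, min_eq_right hx.2, max_eq_right hx.1]
  have heq : EqOn (fun x => f (r x) + κ * (x - r x)) f (Icc 0 1) := fun x hx => by
    simp only [hri x hx, sub_self, mul_zero, add_zero]
  refine ⟨fun x => f (r x) + κ * (x - r x), ⟨hκ0, hκ, fun x y h => ?_, fun x y h => ?_, ?_, ?_⟩, heq⟩
  · have a := hrs x y h.le
    change f (r x) + κ * (x - r x) < f (r y) + κ * (y - r y)
    rcases (hrm h.le).eq_or_lt with b | b
    · rw [b]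
      nlinarith
    · have := hmono (hr x) (hr y) b
      nlinarith
  · have a := hcontr (r y) (hr y) (r x) (hr x)
    change f (r y) + κ * (y - r y) - (f (r x) + κ * (x - r x)) ≤ κ * (y - x)
    rw [abs_of_nonneg (sub_nonneg.2 (hrm h))] at a
    have := le_abs_self (f (r y) - f (r x))
    linarith
  · exact (heq m0).trans h0
  · exact (heq m1).trans_lt h1

lemma familyMap_eq_fract {f g : ℝ → ℝ} {κ : ℝ} (hg : IsContractiveProfile g κ)
    (heq : EqOn g f (Icc 0 1)) {c : ℝ} (hc : c ∈ Ioo (0 : ℝ) 1) {x : ℝ} (hx : x ∈ Ico (0 : ℝ) 1) :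
    familyMap f c x = Int.fract (lift g (1 - f c) x) := by
  rw [lift, Int.fract_eq_self.2 hx, Int.floor_eq_zero_iff.2 hx, heq ⟨hx.1, hx.2.le⟩, ← heq ⟨hc.1.le, hc.2.le⟩,
    familyMap, ← heq ⟨hx.1, hx.2.le⟩, ← heq ⟨hc.1.le, hc.2.le⟩]
  have h1 := hg.zero
  have h2 := hg.one_lt
  have h3 := hg.strictMono.monotone hx.1
  have h4 := hg.strictMono hx.2
  have h5 := hg.strictMono hc.1
  have h6 := hg.strictMono hc.2
  split_ifs with h
  · have := hg.strictMono h
    refine (Int.fract_eq_iff.2 ⟨by linarith, by linarith, 0, ?_⟩).symm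
    push_cast
    ring
  · have := hg.strictMono.monotone (not_lt.1 h)
    refine (Int.fract_eq_iff.2 ⟨by linarith, by linarith, 1, ?_⟩).symm
    push_cast
    ring

lemma linearMap_eq_fract (α β : ℝ) {x : ℝ} (hx : x ∈ Ico (0 : ℝ) 1) :
    linearMap α β x = Int.fract (lift (fun x => α * x) β x) := by
  rw [linearMap, lift, Int.fract_eq_self.2 hx, Int.floor_eq_zero_iff.2 hx]
  simp

lemma Admissible.pos {n l : ℕ} (h : Admissible n l) : 0 < l := by
  obtain ⟨h1, -, h3⟩ := h
  rcases Nat.eq_zero_or_pos l with rfl | h0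
  · rw [Nat.coprime_zero_right] at h3
    omega
  · exact h0

lemma Admissible.mediant {n l n' l' : ℕ} (h : Admissible n l) (h' : Admissible n' l')
    (hdet : (n' : ℤ) * l - n * l' = 1) : Admissible (n + n') (l + l') := by
  refine ⟨by have := h.1; omega, by have := h.2.1; have := h'.2.1; omega, ?_⟩
  rw [← Nat.isCoprime_iff_coprime]
  refine ⟨-l', n', ?_⟩
  push_cast
  linarith

theorem theorem4p3 (f : ℝ → ℝ)
    (hmaps : MapsTo f (Icc (0 : ℝ) 1) (Icc 0 1))
    (hmono : StrictMonoOn f (Icc (0 : ℝ) 1))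
    (hcont : ContinuousOn f (Icc (0 : ℝ) 1))
    (h0 : f 0 = 0) (h1 : f 1 < 1)
    (hcontr : ∃ κ : ℝ, κ < 1 ∧
      ∀ x ∈ Icc (0 : ℝ) 1, ∀ y ∈ Icc (0 : ℝ) 1, |f x - f y| ≤ κ * |x - y|) :
    ∃ cL cR : ℕ → ℕ → ℝ,
      (∀ n l : ℕ, Admissible n l →
        0 < cL n l ∧ cL n l < cR n l ∧ cR n l < 1 ∧
        (interior (regionD n l)).Nonempty ∧
        ∀ c ∈ Ioo (cL n l) (cR n l), ∀ p ∈ interior (regionD n l),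
          TopConjugate (familyMap f c) (linearMap p.1 p.2)) ∧
      (∀ n l n' l' : ℕ, Admissible n l → Admissible n' l' →
        (n' : ℤ) * l - n * l' = 1 →
        cR n l < cL (n + n') (l + l') ∧
        cL (n + n') (l + l') < cR (n + n') (l + l') ∧
        cR (n + n') (l + l') < cL n' l') := by
  obtain ⟨κ, hκ, hcontr⟩ := hcontr
  obtain ⟨g, hg, heq⟩ := exists_isContractiveProfile hmono h0 h1 hκ hcontr
  have exR : ∀ n l : ℕ, ∃ c : ℝ, Admissible n l →
      c ∈ Ioo (0 : ℝ) 1 ∧ ∃ P, IsOrbit g n l (1 - g c) P ∧ P 0 = 0 := by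
    intro n l
    by_cases h : Admissible n l
    · have hn : 0 < n := by have := h.1; omega
      obtain ⟨d, P, hP, hz⟩ := exists_isOrbit_eq_zero hg hn l 0
      obtain ⟨a, b⟩ := hP.discontinuity hg hn h.2.2 h.pos h.2.1 (Or.inl rfl) hz
      exact ⟨_, fun _ => ⟨a, P, by rwa [b, sub_sub_cancel], hz⟩⟩
    · exact ⟨0, fun h' => absurd h' h⟩
  have exL : ∀ n l : ℕ, ∃ c : ℝ, Admissible n l →
      c ∈ Ioo (0 : ℝ) 1 ∧ ∃ P, IsOrbit g n l (1 - g c) P ∧ P 1 = 0 := by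
    intro n l
    by_cases h : Admissible n l
    · have hn : 0 < n := by have := h.1; omega
      obtain ⟨d, P, hP, hz⟩ := exists_isOrbit_eq_zero hg hn l 1
      obtain ⟨a, b⟩ := hP.discontinuity hg hn h.2.2 h.pos h.2.1 (Or.inr rfl) hz
      exact ⟨_, fun _ => ⟨a, P, by rwa [b, sub_sub_cancel], hz⟩⟩
    · exact ⟨0, fun h' => absurd h' h⟩
  -- The translation 1 - g c decreases with c, so the upper end translation, where P 0 = 0, gives
  -- the left end of the c-interval, and the lower one gives the right end.
  choose cL hcL using exR
  choose cR hcR using exL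
  have hlt : ∀ n l, Admissible n l → cL n l < cR n l := by
    intro n l h
    obtain ⟨-, P, hP, hz⟩ := hcL n l h
    obtain ⟨-, Q, hQ, hz'⟩ := hcR n l h
    have := IsOrbit.translation_lt hg (by have := h.1; omega) h.2.2 hQ hz' hP hz
    exact hg.strictMono.lt_iff_lt.1 (by linarith)
  have hord : ∀ n l n' l', Admissible n l → Admissible n' l' → n * l' < n' * l →
      cR n l < cL n' l' := by
    intro n l n' l' h h' hrot
    obtain ⟨-, P, hP, hz⟩ := hcL n' l' h'
    obtain ⟨-, Q, hQ, hz'⟩ := hcR n l h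
    have := hQ.lt_of_rotation_lt hg (by have := h.1; omega) h.2.2 hz' (by have := h'.1; omega)
      h'.2.2 hP hz hrot
    exact hg.strictMono.lt_iff_lt.1 (by linarith)
  refine ⟨cL, cR, fun n l h => ⟨(hcL n l h).1.1, hlt n l h, (hcR n l h).1.2,
    interior_regionD_nonempty h.1 h.pos h.2.1 h.2.2, fun c hc p hp => ?_⟩,
    fun n l n' l' h h' hdet => ?_⟩
  · obtain ⟨mL, P, hP, hz⟩ := hcL n l h
    obtain ⟨mR, Q, hQ, hz'⟩ := hcR n l h
    have hc01 : c ∈ Ioo (0 : ℝ) 1 := ⟨mL.1.trans hc.1, hc.2.trans mR.2⟩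
    have a := hg.strictMono hc.1
    have b := hg.strictMono hc.2
    obtain ⟨R, q, hR⟩ := IsOrbit.exists_isLocked_of_lt hg h.1 h.2.2 hQ hz' hP hz
      (d := 1 - g c) (by linarith) (by linarith)
    obtain ⟨m1, m2, -, m4⟩ := interior_subset hp
    obtain ⟨R', q', hR'⟩ := exists_isLocked_linear m1.1 m1.2 h.1 h.2.1 h.2.2
      (lowerB_lt_of_mem_interior hp) m4
    rw [heq ⟨hc01.1.le, hc01.2.le⟩] at hR
    exact topConjugate_of_isLocked hR hR' (fun x hx => familyMap_eq_fract hg heq hc01 hx)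
      (fun x hx => linearMap_eq_fract p.1 p.2 hx)
  · have hm := h.mediant h' hdet
    refine ⟨hord _ _ _ _ h hm ?_, hlt _ _ hm, hord _ _ _ _ hm h' ?_⟩
    · zify
      linarith
    · zify
      linarith
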